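/- For a mass parameter $m>0$ consider the mass-switching Dirac equation for $\alpha(t,x)\in\mathbb C^2$, $x\in\mathbb R$, $$ i\partial_t\alpha=\big(i\sigma_3\partial_x+\nu(t)\sigma_1\big)\alpha,\qquad \nu(t)=m \text{ for } t\in[2j,2j+1),\quad \nu(t)=-m\text{ for } t\in[2j+1,2j+2),\quad j\in\mathbb Z, $$ where $\sigma_1=\begin{pmatrix}0&1\\1&0\end{pmatrix}$ and $\sigma_3=\begin{pmatrix}1&0\\0&-1\end{pmatrix}$. Let $M=\mathcal U_-(1)\,\mathcal U_+(1)$ be its monodromy operator over one period $[0,2)$; here $\mathcal U_\pm(t)$ is the solution operator with constant mass $\pm m$, that is, multiplication by $\exp\!\big(-it(-\xi\sigma_3\pm m\sigma_1)\big)$ on the side of the Fourier transform $\hat f(\xi)=\int_{\mathbb R}e^{-i\xi x}f(x)\,dx$. Put $$\theta(\xi;m)=\arctan\!\left(\frac{\xi\sin\omega}{\sqrt{m^2+\xi^2\cos^2\omega}}\right),\qquad \omega=\sqrt{m^2+\xi^2},$$ let primes and superscripts $(k)$ on $\theta$ denote derivatives in $\xi$, and let $\Sigma=\{m>0:\ \theta'''(0;m)=0\}$.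 Theorem. Let $m\in\Sigma$. Then $\theta^{(5)}(0;m)\neq0$, and there is $\delta=\delta(m)>0$ such that the following hold for all Schwartz functions $f\in\mathcal S(\mathbb R;\mathbb C^2)$ whose Fourier transform vanishes outside $(-\delta,\delta)$. 1. There is a constant $K$, depending only on $m$, such that for all such $f$ and all $n\ge1$ $$\|M^nf\|_{L^\infty}\le K\,n^{-1/5}\,\|f\|_{L^1}.$$ 2. There are a real number $s_1\neq0$, a constant $C>0$ and an orthogonal projection $Q$ of rank one on $\mathbb C^2$, all depending only on $m$, such that for all such $f$, as $n\to\infty$, $$(M^nf)(ns_1)=C\,Q\begin{pmatrix}\int_{\mathbb R} f_1\,dx\\ \int_{\mathbb R} f_2\,dx\end{pmatrix}n^{-1/5}+O(n^{-2/5}),\qquad (M^nf)(-ns_1)=C\,(I-Q)\begin{pmatrix}\int_{\mathbb R} f_1\,dx\\ \int_{\mathbb R} f_2\,dx\end{pmatrix}n^{-1/5}+O(n^{-2/5}),$$ where the implied constants may depend on $f$ and $m$. 3. Consequently, for every such $f$ there are a real number $s\neq0$ and a constant $C'>0$ (which may depend on $f$) such that, with $x_n=ns$ and $|\cdot|$ the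 Euclidean norm of $\mathbb C^2$, $$\big|(M^nf)(x_n)\big|=C'\left|\begin{pmatrix}\int_{\mathbb R} f_1\,dx\\ \int_{\mathbb R} f_2\,dx\end{pmatrix}\right|n^{-1/5}+O(n^{-2/5}).$$ -/

import Mathlib

open scoped SchwartzMap Matrix

/-- The spinor space `ℂ²` with its Euclidean norm. -/
abbrev Spinor : Type := EuclideanSpace ℂ (Fin 2)

/-- The Pauli matrix `σ₁`. -/
def sigma1 : Matrix (Fin 2) (Fin 2) ℂ := !![0, 1; 1, 0]

/-- The Pauli matrix `σ₃`. -/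
def sigma3 : Matrix (Fin 2) (Fin 2) ℂ := !![1, 0; 0, -1]

noncomputable section

/-- The Fourier transform `f̂(ξ) = ∫ e^{-iξx} f(x) dx`. -/
def fourierHat (f : ℝ → Spinor) (ξ : ℝ) : Spinor :=
  ∫ x : ℝ, Complex.exp (-(Complex.I * ξ * x)) • f x

/-- The inverse Fourier transform `(2π)⁻¹ ∫ e^{iξx} g(ξ) dξ`. -/
def fourierCheck (g : ℝ → Spinor) (x : ℝ) : Spinor :=
  ((2 * Real.pi : ℝ) : ℂ)⁻¹ • ∫ ξ : ℝ, Complex.exp (Complex.I * ξ * x) • g ξ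

/-- The symbol `-ξ σ₃ + μ σ₁` of the Dirac operator `i σ₃ ∂ₓ + μ σ₁`. -/
def diracSymbol (μ ξ : ℝ) : Matrix (Fin 2) (Fin 2) ℂ :=
  (-(ξ : ℂ)) • sigma3 + (μ : ℂ) • sigma1

/-- The solution operator at time `t` of the constant-mass Dirac equation
`i ∂ₜ α = (i σ₃ ∂ₓ + μ σ₁) α`: in Fourier variables, multiplication by
`exp (-i t (-ξ σ₃ + μ σ₁))`. -/
def diracFlow (μ t : ℝ) (f : ℝ → Spinor) : ℝ → Spinor :=
  fourierCheck fun ξ =>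
    Matrix.toEuclideanLin (NormedSpace.exp ((-(Complex.I * t)) • diracSymbol μ ξ))
      (fourierHat f ξ)

/-- The monodromy operator over one period `[0, 2)` of the mass-switching Dirac equation:
mass `m` for a unit of time, then mass `-m` for a unit of time. -/
def monodromy (m : ℝ) (f : ℝ → Spinor) : ℝ → Spinor :=
  diracFlow (-m) 1 (diracFlow m 1 f)

/-- `ω(ξ; m) = √(m² + ξ²)`. -/
def omega (m ξ : ℝ) : ℝ := Real.sqrt (m ^ 2 + ξ ^ 2)

/-- The dispersion relation
`θ(ξ; m) = arctan (ξ sin ω / √(m² + ξ² cos² ω))`. -/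
def theta (m ξ : ℝ) : ℝ :=
  Real.arctan (ξ * Real.sin (omega m ξ) /
    Real.sqrt (m ^ 2 + ξ ^ 2 * Real.cos (omega m ξ) ^ 2))

/-- The set `Σ` of exceptional masses: those `m > 0` with `θ'''(0; m) = 0`. -/
def exceptionalMasses : Set ℝ :=
  {m | 0 < m ∧ iteratedDeriv 3 (theta m) 0 = 0}

end

/- Check of the definitions: on Schwartz data `diracFlow` is the classical solution of the
constant-mass Dirac equation. -/

namespace MassSwitching

open MeasureTheory FourierTransform

theorem fourierHat_eq (f : ℝ → Spinor) (ξ : ℝ) :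
    fourierHat f ξ = 𝓕 f (ξ / (2 * Real.pi)) := by
  rw [fourierHat, Real.fourier_real_eq_integral_exp_smul]
  congr 1; ext1 x; congr 2
  have : (Real.pi : ℂ) ≠ 0 := by exact_mod_cast Real.pi_ne_zero
  push_cast; field_simp

theorem fourierCheck_fourierHat (f : 𝓢(ℝ, Spinor)) : fourierCheck (fourierHat f) = f := by
  ext1 x
  have h2 : (0 : ℝ) < 2 * Real.pi := by positivity
  have h3 : (fourierHat f) = fun ξ => 𝓕 (f : ℝ → Spinor) (ξ / (2 * Real.pi)) := by
    ext1 ξ; exact fourierHat_eq _ _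
  have h4 : (f : ℝ → Spinor) x = 𝓕⁻ (𝓕 (f : ℝ → Spinor)) x := by
    rw [f.continuous.fourierInv_fourier_eq f.integrable]
    rw [← SchwartzMap.fourier_coe]; exact SchwartzMap.integrable _
  rw [h4, Real.fourierInv_eq', fourierCheck, h3]
  have h5 := Measure.integral_comp_div (fun v : ℝ => Complex.exp ((2 * Real.pi * v * x : ℝ) * Complex.I) • 𝓕 (f : ℝ → Spinor) v) (2 * Real.pi)
  rw [abs_of_pos h2] at h5
  have h6 : (∫ ξ : ℝ, Complex.exp (Complex.I * ξ * x) • 𝓕 (f : ℝ → Spinor) (ξ / (2 * Real.pi))) =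
    ∫ ξ : ℝ, Complex.exp ((2 * Real.pi * (ξ / (2 * Real.pi)) * x : ℝ) * Complex.I) • 𝓕 (f : ℝ → Spinor) (ξ / (2 * Real.pi)) := by
    congr 1; ext1 ξ; congr 2
    rw [mul_div_cancel₀ _ h2.ne']; push_cast; ring
  rw [h6, h5, ← Complex.coe_smul, smul_smul]
  rw [inv_mul_cancel₀ (by exact_mod_cast h2.ne'), one_smul]
  congr 1; ext1 v; congr 3
  simp only [RCLike.inner_apply, conj_trivial]; ring_nf

/-- At time zero the flow is the identity on Schwartz data. -/
theorem diracFlow_zero (μ : ℝ) (f : 𝓢(ℝ, Spinor)) : diracFlow μ 0 f = f := by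
  simp [diracFlow, NormedSpace.exp_zero, fourierCheck_fourierHat]

theorem diracSymbol_conjTranspose (μ ξ : ℝ) : (diracSymbol μ ξ)ᴴ = diracSymbol μ ξ := by
  ext i j; fin_cases i <;> fin_cases j <;> simp [diracSymbol, sigma1, sigma3]

/-- The flow symbol `exp (-i t (-ξ σ₃ + μ σ₁))` preserves the norm of `ℂ²`. -/
theorem norm_exp_diracSymbol (μ t ξ : ℝ) (v : Spinor) :
    ‖Matrix.toEuclideanLin (NormedSpace.exp ((-(Complex.I * t)) • diracSymbol μ ξ)) v‖ = ‖v‖ := by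
  set X := (-(Complex.I * t)) • diracSymbol μ ξ with hX
  have h1 : Xᴴ = -X := by
    rw [hX, Matrix.conjTranspose_smul, diracSymbol_conjTranspose]; simp
  have h2 : (NormedSpace.exp X)ᴴ * NormedSpace.exp X = 1 := by
    rw [← Matrix.exp_conjTranspose, h1, ← Matrix.exp_add_of_commute _ _ ((Commute.refl X).neg_left)]
    simp
  have h3 : inner ℂ (Matrix.toEuclideanLin (NormedSpace.exp X) v)
      (Matrix.toEuclideanLin (NormedSpace.exp X) v) = inner ℂ v v := by
    rw [← LinearMap.adjoint_inner_right, ← Matrix.toEuclideanLin_conjTranspose_eq_adjoint]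
    congr 1
    rw [← LinearMap.comp_apply, ← Matrix.toLpLin_mul_same, h2]; simp
  have h4 := congrArg Complex.re h3
  rw [inner_self_eq_norm_sq_to_K, inner_self_eq_norm_sq_to_K] at h3
  have h5 : ‖Matrix.toEuclideanLin (NormedSpace.exp X) v‖ ^ 2 = ‖v‖ ^ 2 := by exact_mod_cast h3
  exact (sq_eq_sq₀ (norm_nonneg _) (norm_nonneg _)).1 h5

theorem norm_sigma1 (v : Spinor) : ‖Matrix.toEuclideanLin sigma1 v‖ = ‖v‖ := by
  simp [EuclideanSpace.norm_eq, Fin.sum_univ_two, sigma1, Matrix.toLpLin_apply, Matrix.vecHead,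
    Matrix.vecTail]
  rw [add_comm]

theorem norm_sigma3 (v : Spinor) : ‖Matrix.toEuclideanLin sigma3 v‖ = ‖v‖ := by
  simp [EuclideanSpace.norm_eq, Fin.sum_univ_two, sigma3, Matrix.toLpLin_apply, Matrix.vecHead, Matrix.vecTail]

theorem diracSymbol_apply (μ ξ : ℝ) (v : Spinor) :
    Matrix.toEuclideanLin (diracSymbol μ ξ) v =
      (-(ξ : ℂ)) • Matrix.toEuclideanLin sigma3 v + (μ : ℂ) • Matrix.toEuclideanLin sigma1 v := by
  rw [diracSymbol, map_add, map_smul, map_smul, LinearMap.add_apply, LinearMap.smul_apply,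
    LinearMap.smul_apply]

theorem continuous_toEuclideanLin {X : Type*} [TopologicalSpace X]
    {A : X → Matrix (Fin 2) (Fin 2) ℂ} {v : X → Spinor} (hA : Continuous A) (hv : Continuous v) :
    Continuous fun x => Matrix.toEuclideanLin (A x) (v x) := by
  simp only [Matrix.toLpLin_apply]
  fun_prop

section
attribute [local instance] Matrix.linftyOpNormedRing Matrix.linftyOpNormedAlgebra

theorem continuous_exp_diracSymbol (μ t : ℝ) :
    Continuous fun ξ : ℝ => NormedSpace.exp ((-(Complex.I * t)) • diracSymbol μ ξ) := by
  refine NormedSpace.exp_continuous.comp ?_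
  unfold diracSymbol
  fun_prop

theorem hasDerivAt_exp_diracSymbol (μ ξ t : ℝ) (v : Spinor) :
    HasDerivAt (fun s : ℝ =>
      Matrix.toEuclideanLin (NormedSpace.exp ((-(Complex.I * s)) • diracSymbol μ ξ)) v)
      ((-Complex.I) • Matrix.toEuclideanLin (diracSymbol μ ξ)
        (Matrix.toEuclideanLin (NormedSpace.exp ((-(Complex.I * t)) • diracSymbol μ ξ)) v)) t := by
  have h := hasDerivAt_exp_smul_const' (𝕂 := ℝ) ((-Complex.I) • diracSymbol μ ξ) t
  have hs : ∀ s : ℝ, s • ((-Complex.I) • diracSymbol μ ξ) =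
      (-(Complex.I * s)) • diracSymbol μ ξ := by
    intro s
    rw [← Complex.coe_smul, smul_smul]; congr 1; ring
  simp only [hs] at h
  let L : Matrix (Fin 2) (Fin 2) ℂ →ₗ[ℝ] Spinor :=
    { toFun := fun A => Matrix.toEuclideanLin A v
      map_add' := by intros; simp
      map_smul' := by
        intro c A
        have : c • A = (c : ℂ) • A := by ext i j; simp
        rw [this, map_smul, LinearMap.smul_apply, Complex.coe_smul]; rfl }
  have h2 := L.toContinuousLinearMap.hasFDerivAt.comp_hasDerivAt t h
  refine h2.congr_deriv ?_
  change Matrix.toEuclideanLin (((-Complex.I) • diracSymbol μ ξ) * _) v = _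
  rw [smul_mul_assoc, map_smul, LinearMap.smul_apply, Matrix.toLpLin_mul_same]
  rfl
end

theorem integrable_fourierHat (f : 𝓢(ℝ, Spinor)) (k : ℕ) :
    Integrable fun ξ => |ξ| ^ k * ‖fourierHat f ξ‖ := by
  have h2 : (0 : ℝ) < 2 * Real.pi := by positivity
  have h := ((SchwartzMap.integrable_pow_mul volume (𝓕 f) k).comp_div h2.ne').const_mul
    ((2 * Real.pi) ^ k)
  refine h.congr (Filter.Eventually.of_forall fun ξ => ?_)
  simp only [fourierHat_eq, SchwartzMap.fourier_coe, Real.norm_eq_abs, abs_div, div_pow,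
    abs_of_pos h2]
  field_simp

theorem continuous_fourierHat (f : 𝓢(ℝ, Spinor)) : Continuous (fourierHat f) := by
  have : fourierHat f = fun ξ => (𝓕 f : 𝓢(ℝ, Spinor)) (ξ / (2 * Real.pi)) := by
    ext1 ξ; rw [fourierHat_eq, SchwartzMap.fourier_coe]
  rw [this]
  exact (𝓕 f).continuous.comp (by fun_prop)

set_option maxHeartbeats 400000 in
/-- For Schwartz data, `diracFlow` is a classical solution of
`i ∂ₜ α = i σ₃ ∂ₓ α + μ σ₁ α`. -/
theorem diracFlow_solves (μ : ℝ) (f : 𝓢(ℝ, Spinor)) (t x : ℝ) :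
    ∃ ut ux : Spinor, HasDerivAt (fun s => diracFlow μ s f x) ut t ∧
      HasDerivAt (fun y => diracFlow μ t f y) ux x ∧
      Complex.I • ut = Complex.I • Matrix.toEuclideanLin sigma3 ux +
        (μ : ℂ) • Matrix.toEuclideanLin sigma1 (diracFlow μ t f x) := by
  obtain ⟨w, hw, hwc, hwn, hwd⟩ : ∃ w : ℝ → ℝ → Spinor,
      (∀ s, diracFlow μ s f = fourierCheck (w s)) ∧ (∀ s, Continuous (w s)) ∧
      (∀ s ξ, ‖w s ξ‖ = ‖fourierHat f ξ‖) ∧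
      ∀ ξ s, HasDerivAt (fun s => w s ξ)
        ((-Complex.I) • Matrix.toEuclideanLin (diracSymbol μ ξ) (w s ξ)) s :=
    ⟨fun s ξ => Matrix.toEuclideanLin
      (NormedSpace.exp ((-(Complex.I * s)) • diracSymbol μ ξ)) (fourierHat f ξ),
      fun s => rfl,
      fun s => continuous_toEuclideanLin (continuous_exp_diracSymbol μ s)
        (continuous_fourierHat f),
      fun s ξ => norm_exp_diracSymbol μ s ξ _,
      fun ξ s => hasDerivAt_exp_diracSymbol μ ξ s _⟩
  have hen : ∀ ξ y : ℝ, ‖Complex.exp (Complex.I * ξ * y)‖ = 1 := fun ξ y => by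
    rw [Complex.norm_exp]; simp
  have hec : ∀ y : ℝ, Continuous fun ξ : ℝ => Complex.exp (Complex.I * ξ * y) := fun y => by
    fun_prop
  have hi0 := integrable_fourierHat f 0
  have hi1 := integrable_fourierHat f 1
  simp only [pow_zero, one_mul, pow_one] at hi0 hi1
  have hint : ∀ (s y : ℝ), Integrable fun ξ : ℝ => Complex.exp (Complex.I * ξ * y) • w s ξ :=
    fun s y => hi0.mono' ((hec y).smul (hwc s)).aestronglyMeasurable
      (Filter.Eventually.of_forall fun ξ => by rw [norm_smul, hen, hwn, one_mul])
  have hDb : ∀ (ξ : ℝ) (v : Spinor),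
      ‖Matrix.toEuclideanLin (diracSymbol μ ξ) v‖ ≤ |ξ| * ‖v‖ + |μ| * ‖v‖ := fun ξ v => by
    rw [diracSymbol_apply]
    refine (norm_add_le _ _).trans ?_
    rw [norm_smul, norm_smul, norm_sigma1, norm_sigma3]; simp
  have hDc : Continuous fun ξ : ℝ => diracSymbol μ ξ := by unfold diracSymbol; fun_prop
  have hb : Integrable fun ξ => |ξ| * ‖fourierHat f ξ‖ + |μ| * ‖fourierHat f ξ‖ :=
    hi1.add (hi0.const_mul _)
  have hF : ∀ ξ s : ℝ, HasDerivAt (fun s : ℝ => Complex.exp (Complex.I * ξ * x) • w s ξ)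
      (Complex.exp (Complex.I * ξ * x) •
        ((-Complex.I) • Matrix.toEuclideanLin (diracSymbol μ ξ) (w s ξ))) s :=
    fun ξ s => (hwd ξ s).const_smul (Complex.exp (Complex.I * ξ * x))
  have hm : Continuous fun ξ : ℝ => Complex.exp (Complex.I * ξ * x) •
        ((-Complex.I) • Matrix.toEuclideanLin (diracSymbol μ ξ) (w t ξ)) := by
    have h1 := hec x
    have h2 := continuous_toEuclideanLin hDc (hwc t)
    fun_prop
  obtain ⟨hA, hAd⟩ := hasDerivAt_integral_of_dominated_loc_of_deriv_le (𝕜 := ℝ) (μ := volume)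
    (x₀ := t) (s := Set.univ) (bound := fun ξ => |ξ| * ‖fourierHat f ξ‖ + |μ| * ‖fourierHat f ξ‖)
    (F := fun s ξ => Complex.exp (Complex.I * ξ * x) • w s ξ)
    (F' := fun s ξ => Complex.exp (Complex.I * ξ * x) •
      ((-Complex.I) • Matrix.toEuclideanLin (diracSymbol μ ξ) (w s ξ)))
    Filter.univ_mem
    (Filter.Eventually.of_forall fun s => (hint s x).aestronglyMeasurable) (hint t x)
    hm.aestronglyMeasurable
    (Filter.Eventually.of_forall fun ξ s _ => by
      rw [norm_smul, hen, one_mul, norm_smul, norm_neg, Complex.norm_I, one_mul, ← hwn s ξ]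
      exact hDb ξ _)
    hb
    (Filter.Eventually.of_forall fun ξ s _ => hF ξ s)
  have hm2 : Continuous fun ξ : ℝ =>
      (Complex.exp (Complex.I * ξ * x) * (Complex.I * ξ)) • w t ξ := by
    have h1 := hec x
    have h2 := hwc t
    fun_prop
  obtain ⟨hB, hBd⟩ := hasDerivAt_integral_of_dominated_loc_of_deriv_le (𝕜 := ℝ) (μ := volume)
    (x₀ := x) (s := Set.univ) (bound := fun ξ => |ξ| * ‖fourierHat f ξ‖)
    (F := fun y ξ => Complex.exp (Complex.I * ξ * y) • w t ξ)
    (F' := fun y ξ => (Complex.exp (Complex.I * ξ * y) * (Complex.I * ξ)) • w t ξ)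
    Filter.univ_mem
    (Filter.Eventually.of_forall fun y => (hint t y).aestronglyMeasurable) (hint t x)
    hm2.aestronglyMeasurable
    (Filter.Eventually.of_forall fun ξ y _ => by
      rw [norm_smul, norm_mul, hen, hwn]; simp)
    hi1
    (Filter.Eventually.of_forall fun ξ y _ => by
      refine HasDerivAt.smul_const ?_ _
      have h := ((Complex.ofRealCLM.hasDerivAt (x := y)).const_mul (Complex.I * ξ)).cexp
      simpa using h)
  simp only [hw, fourierCheck]
  refine ⟨_, _, hAd.const_smul (((2 * Real.pi : ℝ) : ℂ)⁻¹),
    hBd.const_smul (((2 * Real.pi : ℝ) : ℂ)⁻¹), ?_⟩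
  have e3 := (LinearMap.toContinuousLinearMap (Matrix.toEuclideanLin sigma3)).integral_comp_comm hB
  have e1 := (LinearMap.toContinuousLinearMap
    (Matrix.toEuclideanLin sigma1)).integral_comp_comm (hint t x)
  have i3 := (LinearMap.toContinuousLinearMap (Matrix.toEuclideanLin sigma3)).integrable_comp hB
  have i1 := (LinearMap.toContinuousLinearMap
    (Matrix.toEuclideanLin sigma1)).integrable_comp (hint t x)
  simp only [LinearMap.coe_toContinuousLinearMap'] at e1 e3 i1 i3
  simp only [map_smul]
  rw [← e1, ← e3, smul_comm Complex.I, smul_comm Complex.I, smul_comm (μ : ℂ), ← smul_add]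
  congr 1
  rw [← integral_smul, ← integral_smul, ← integral_smul]
  refine Eq.trans ?_ (integral_add (i3.smul Complex.I) (i1.smul (μ : ℂ)))
  congr 1; ext1 ξ
  simp only [map_smul, diracSymbol_apply, smul_add, smul_smul]
  congr 1
  · congr 1
    ring
  · congr 1
    linear_combination (-Complex.exp (Complex.I * ξ * x) * μ) * Complex.I_mul_I

end MassSwitching

/-! On the Fourier side `M` is multiplication by a 2×2 matrix with eigenvalues e^{±2iθ(ξ)} and
spectral projections P_±(ξ) that are analytic in ξ (`monodromySymbol_eq`). Hence (Mⁿf)(x) is (2π)⁻¹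
times the sum of the two oscillatory integrals of e^{i(ξx ± 2nθ)} P_± f̂ over (-δ, δ)
(`iterate_monodromy_apply`), and only the behaviour of θ near 0 matters.

Differentiating sin θ = ξ sin ω / ω gives, with S = sin m / m, θ'(0) = S, θ''(0) = θ⁽⁴⁾(0) = 0 and,
once θ'''(0) = 0, θ⁽⁵⁾(0) = -S (15 (1 - S²) / m² + S⁴). This is nonzero because 0 < |S| ≤ 1
(`theta_derivatives_of_mem`).

Upper bound: the fifth derivative of either phase is ±2nθ⁽⁵⁾, independent of x, so van der Corput's
lemma of order five gives n^{-1/5} uniformly in x. To involve only the L¹ norm of f, it is applied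
to the convolution kernel, which is then integrated against f (`exists_branch_bound`).

Expansion: at x = ns with s = -2θ'(0), the plus phase is 2n(θ(ξ) - θ'(0)ξ). It vanishes to order
exactly five, so it equals n y(ξ)⁵ for an analytic coordinate y (`exists_fifth_root`). Rescaling by
n^{1/5} produces the complete quintic Fresnel integral 2 Re Λ > 0 times P_+(0) f̂(0) / |y'(0)|,
where f̂(0) = ∫ f (`exists_stationary_branch`). The minus phase has the nonvanishing derivative
-2n(θ'(ξ) + θ'(0)) and contributes O(1/n) (`exists_nonstationary_branch`). At -ns the branches
exchange roles, and P_-(0) = I - P_+(0). If ∫ f ≠ 0, one of the two complementary projections does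
not annihilate it, which gives the statement on the modulus. -/

namespace MassSwitching

open MeasureTheory FourierTransform Set Filter Topology

open scoped ContDiff

noncomputable section

/-! ### Unimodular exponentials -/

/-- The unimodular number `e^{it}`. -/
def phase (t : ℝ) : ℂ := Complex.exp (Complex.I * t)

theorem phase_zero : phase 0 = 1 := by simp [phase]

theorem phase_add (s t : ℝ) : phase (s + t) = phase s * phase t := by
  simp only [phase, ← Complex.exp_add]; push_cast; ring_nf

theorem norm_phase (t : ℝ) : ‖phase t‖ = 1 := by
  rw [phase, Complex.norm_exp]; simp

theorem phase_neg (t : ℝ) : phase (-t) = starRingEnd ℂ (phase t) := by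
  simp [phase, ← Complex.exp_conj]

theorem phase_eq (t : ℝ) : phase t = Real.cos t + Real.sin t * Complex.I := by
  rw [phase, mul_comm, Complex.exp_mul_I]; push_cast; rfl

@[fun_prop]
theorem continuous_phase : Continuous phase := by unfold phase; fun_prop

theorem hasDerivAt_phase_comp {φ : ℝ → ℝ} {φ' x : ℝ} (h : HasDerivAt φ φ' x) :
    HasDerivAt (fun y => phase (φ y)) (Complex.I * φ' * phase (φ x)) x := by
  have := (h.ofReal_comp.const_mul Complex.I).cexp
  refine this.congr_deriv ?_
  rw [phase]; ring

theorem norm_integral_phase_neg (φ : ℝ → ℝ) (a b : ℝ) :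
    ‖∫ x in a..b, phase (-φ x)‖ = ‖∫ x in a..b, phase (φ x)‖ := by
  simp only [phase_neg]
  rw [intervalIntegral.intervalIntegral_conj, RCLike.norm_conj]

/-! ### Integration by parts against an amplitude -/

/-- Integration by parts: of the oscillating factor only the size of a primitive matters. This
serves both van der Corput with an amplitude and the non-stationary phase bound. -/
theorem norm_integral_smul_le_of_hasDerivAt {E : Type*} [NormedAddCommGroup E] [NormedSpace ℂ E]
    [CompleteSpace E] {F e : ℝ → ℂ} {g g' : ℝ → E} {a b B G₀ G₁ : ℝ} (hab : a ≤ b)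
    (hF : ∀ x ∈ Icc a b, HasDerivAt F (e x) x) (he : ContinuousOn e (Icc a b))
    (hB : ∀ x ∈ Icc a b, ‖F x‖ ≤ B)
    (hg : ∀ x ∈ Icc a b, HasDerivAt g (g' x) x) (hg' : ContinuousOn g' (Icc a b))
    (hG₀ : ∀ x ∈ Icc a b, ‖g x‖ ≤ G₀) (hG₁ : ∀ x ∈ Icc a b, ‖g' x‖ ≤ G₁) :
    ‖∫ x in a..b, e x • g x‖ ≤ B * (2 * G₀ + (b - a) * G₁) := by
  have hB0 : 0 ≤ B := (norm_nonneg _).trans (hB a (left_mem_Icc.2 hab))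
  rw [← uIcc_of_le hab] at hF he hg hg'
  have hFc : ContinuousOn F (uIcc a b) := fun x hx => (hF x hx).continuousAt.continuousWithinAt
  have hgc : ContinuousOn g (uIcc a b) := fun x hx => (hg x hx).continuousAt.continuousWithinAt
  have key := intervalIntegral.integral_deriv_smul_eq_sub_of_hasDeriv_right (𝕜 := ℂ) hFc hgc
    (fun x hx => (hF x (Ioo_subset_Icc_self hx)).hasDerivWithinAt)
    (fun x hx => (hg x (Ioo_subset_Icc_self hx)).hasDerivWithinAt)
    he.intervalIntegrable hg'.intervalIntegrable
  have hi1 : IntervalIntegrable (fun x => e x • g x) volume a b :=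
    (he.smul hgc).intervalIntegrable
  have hi2 : IntervalIntegrable (fun x => F x • g' x) volume a b :=
    (hFc.smul hg').intervalIntegrable
  rw [intervalIntegral.integral_add hi1 hi2] at key
  rw [eq_sub_of_add_eq key]
  have h1 : ‖∫ x in a..b, F x • g' x‖ ≤ B * G₁ * |b - a| :=
    intervalIntegral.norm_integral_le_of_norm_le_const fun x hx => by
      rw [uIoc_of_le hab] at hx
      rw [norm_smul]
      exact mul_le_mul (hB x (Ioc_subset_Icc_self hx)) (hG₁ x (Ioc_subset_Icc_self hx))
        (norm_nonneg _) hB0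
  rw [abs_of_nonneg (sub_nonneg.2 hab)] at h1
  have h2 : ∀ x ∈ Icc a b, ‖F x • g x‖ ≤ B * G₀ := fun x hx => by
    rw [norm_smul]
    exact mul_le_mul (hB x hx) (hG₀ x hx) (norm_nonneg _) hB0
  calc _ ≤ ‖F b • g b‖ + ‖F a • g a‖ + ‖∫ x in a..b, F x • g' x‖ :=
        (norm_sub_le _ _).trans (by gcongr; exact norm_sub_le _ _)
    _ ≤ B * G₀ + B * G₀ + B * G₁ * (b - a) := by
        gcongr
        · exact h2 b (right_mem_Icc.2 hab)
        · exact h2 a (left_mem_Icc.2 hab)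
    _ = _ := by ring

/-! ### Van der Corput's lemma -/

/-- First-derivative test. Writing e^{iφ} as (e^{iφ})' / (iφ') and integrating by parts, the
derivative of 1/φ' has constant sign, so the integral of its modulus telescopes to boundary values.
Four terms of size 1/l result. -/
theorem norm_integral_phase_le_of_le_abs_deriv {φ φ' φ'' : ℝ → ℝ} {a b l : ℝ} (hab : a ≤ b)
    (h1 : ∀ x ∈ Icc a b, HasDerivAt φ (φ' x) x) (h2 : ∀ x ∈ Icc a b, HasDerivAt φ' (φ'' x) x)
    (hc : ContinuousOn φ'' (Icc a b)) (hpos : ∀ x ∈ Icc a b, 0 ≤ φ'' x) (hl : 0 < l)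
    (hle : ∀ x ∈ Icc a b, l ≤ |φ' x|) :
    ‖∫ x in a..b, phase (φ x)‖ ≤ 4 / l := by
  have hne : ∀ x ∈ Icc a b, φ' x ≠ 0 := fun x hx h => by
    have := hle x hx; rw [h, abs_zero] at this; linarith
  have hinv : ∀ x ∈ Icc a b, |(φ' x)⁻¹| ≤ 1 / l := fun x hx => by
    rw [abs_inv, inv_eq_one_div]; exact one_div_le_one_div_of_le hl (hle x hx)
  have hu : ∀ x ∈ uIcc a b, HasDerivAt (fun x => -Complex.I * ((φ' x)⁻¹ : ℝ))
      (-Complex.I * (-φ'' x / φ' x ^ 2 : ℝ)) x := fun x hx => by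
    rw [uIcc_of_le hab] at hx
    exact (((h2 x hx).inv (hne x hx)).ofReal_comp).const_mul _
  have hv : ∀ x ∈ uIcc a b, HasDerivAt (fun x => phase (φ x))
      (Complex.I * φ' x * phase (φ x)) x := fun x hx => by
    rw [uIcc_of_le hab] at hx
    exact hasDerivAt_phase_comp (h1 x hx)
  have hφc : ContinuousOn φ (uIcc a b) := fun x hx =>
    (h1 x (by rwa [uIcc_of_le hab] at hx)).continuousAt.continuousWithinAt
  have hφ'c : ContinuousOn φ' (uIcc a b) := fun x hx =>
    (h2 x (by rwa [uIcc_of_le hab] at hx)).continuousAt.continuousWithinAt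
  rw [← uIcc_of_le hab] at hc
  have hq : ContinuousOn (fun x => -φ'' x / φ' x ^ 2) (uIcc a b) :=
    hc.neg.div (hφ'c.pow 2) fun x hx => pow_ne_zero _ (hne x (by rwa [uIcc_of_le hab] at hx))
  have hpc : ContinuousOn (fun x => phase (φ x)) (uIcc a b) :=
    continuous_phase.comp_continuousOn hφc
  have key := intervalIntegral.integral_mul_deriv_eq_deriv_mul hu hv
    (ContinuousOn.intervalIntegrable (by
      exact continuousOn_const.mul (Complex.continuous_ofReal.comp_continuousOn hq)))
    (ContinuousOn.intervalIntegrable (by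
      exact (continuousOn_const.mul (Complex.continuous_ofReal.comp_continuousOn hφ'c)).mul hpc))
  have e1 : (∫ x in a..b, phase (φ x)) =
      ∫ x in a..b, (-Complex.I * ((φ' x)⁻¹ : ℝ)) * (Complex.I * φ' x * phase (φ x)) := by
    refine intervalIntegral.integral_congr fun x hx => ?_
    have : (φ' x : ℂ) ≠ 0 := by exact_mod_cast hne x (by rwa [uIcc_of_le hab] at hx)
    push_cast
    field_simp
    rw [Complex.I_sq]; ring
  have hF : (∫ x in a..b, -φ'' x / φ' x ^ 2) = (φ' b)⁻¹ - (φ' a)⁻¹ := by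
    refine intervalIntegral.integral_eq_sub_of_hasDerivAt (f := fun x => (φ' x)⁻¹)
      (fun x hx => ?_) hq.intervalIntegrable
    rw [uIcc_of_le hab] at hx
    exact (h2 x hx).inv (hne x hx)
  have h3 : ‖∫ x in a..b, (-Complex.I * (-φ'' x / φ' x ^ 2 : ℝ)) * phase (φ x)‖ ≤
      (φ' a)⁻¹ - (φ' b)⁻¹ := by
    have := intervalIntegral.norm_integral_le_of_norm_le (μ := volume) hab
      (f := fun x => (-Complex.I * (-φ'' x / φ' x ^ 2 : ℝ)) * phase (φ x))
      (g := fun x => -(-φ'' x / φ' x ^ 2)) (Filter.Eventually.of_forall fun x hx => by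
        have hp := hpos x (Ioc_subset_Icc_self hx)
        rw [norm_mul, norm_phase, norm_mul, norm_neg, Complex.norm_I, one_mul, mul_one,
          Complex.norm_real, Real.norm_eq_abs, neg_div, abs_neg, neg_neg,
          abs_of_nonneg (by positivity)]) hq.neg.intervalIntegrable
    rw [intervalIntegral.integral_neg, hF] at this
    linarith
  have hn : ∀ x ∈ Icc a b, ‖(-Complex.I * ((φ' x)⁻¹ : ℝ)) * phase (φ x)‖ ≤ 1 / l :=
    fun x hx => by
      rw [norm_mul, norm_phase, norm_mul, norm_neg, Complex.norm_I, one_mul, mul_one,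
        Complex.norm_real, Real.norm_eq_abs]
      exact hinv x hx
  have ha := hn a (left_mem_Icc.2 hab)
  have hb := hn b (right_mem_Icc.2 hab)
  have ha' := (le_abs_self _).trans (hinv a (left_mem_Icc.2 hab))
  have hb' := (neg_le_abs _).trans (hinv b (right_mem_Icc.2 hab))
  rw [e1, key]
  refine (norm_sub_le _ _).trans ?_
  have := norm_sub_le ((-Complex.I * ((φ' b)⁻¹ : ℝ)) * phase (φ b))
    ((-Complex.I * ((φ' a)⁻¹ : ℝ)) * phase (φ a))
  have e4 : 4 / l = 1 / l + 1 / l + 1 / l + 1 / l := by ring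
  linarith

/-- An increasing function of slope at least `l` vanishes at most once: away from a point `c`
it is at least `l` times the distance to `c` in modulus. -/
theorem exists_mul_dist_le {g g' : ℝ → ℝ} {a b l : ℝ} (hab : a ≤ b)
    (hg : ∀ x ∈ Icc a b, HasDerivAt g (g' x) x) (hl : ∀ x ∈ Icc a b, l ≤ g' x) :
    ∃ c ∈ Icc a b, (∀ x ∈ Icc a b, c < x → l * (x - c) ≤ g x) ∧
      ∀ x ∈ Icc a b, x < c → g x ≤ -(l * (c - x)) := by
  have hc : ContinuousOn g (Icc a b) := fun x hx => (hg x hx).continuousAt.continuousWithinAt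
  have hm : ∀ x ∈ Icc a b, ∀ y ∈ Icc a b, x ≤ y → l * (y - x) ≤ g y - g x :=
    (convex_Icc a b).mul_sub_le_image_sub_of_le_deriv hc
      (fun x hx => (hg x (interior_subset hx)).differentiableAt.differentiableWithinAt)
      (fun x hx => by rw [(hg x (interior_subset hx)).deriv]; exact hl x (interior_subset hx))
  have haI := left_mem_Icc.2 hab
  have hbI := right_mem_Icc.2 hab
  by_cases h1 : 0 ≤ g a
  · exact ⟨a, haI, fun x hx hlt => by linarith [hm a haI x hx hx.1],
      fun x hx hlt => absurd hx.1 (not_le.2 hlt)⟩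
  by_cases h2 : g b ≤ 0
  · exact ⟨b, hbI, fun x hx hlt => absurd hx.2 (not_le.2 hlt),
      fun x hx hlt => by linarith [hm x hx b hbI hx.2]⟩
  obtain ⟨c, hcI, hc0⟩ := intermediate_value_Icc hab hc ⟨(not_le.1 h1).le, (not_le.1 h2).le⟩
  exact ⟨c, hcI, fun x hx hlt => by linarith [hm c hcI x hx hlt.le],
    fun x hx hlt => by linarith [hm x hx c hcI hlt.le]⟩

/-- The inductive step of van der Corput: remove the η-neighbourhood of the only possible zero of g,
at cost 2η. On each of the two remaining pieces g has modulus at least lη and a fixed sign. -/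
theorem norm_integral_le_of_split {e : ℝ → ℂ} {g g' : ℝ → ℝ} {a b l η B : ℝ} (hab : a ≤ b)
    (he : ContinuousOn e (Icc a b)) (he1 : ∀ x ∈ Icc a b, ‖e x‖ ≤ 1)
    (hg : ∀ x ∈ Icc a b, HasDerivAt g (g' x) x) (hl0 : 0 < l) (hl : ∀ x ∈ Icc a b, l ≤ g' x)
    (hη : 0 < η) (hB0 : 0 ≤ B)
    (hB : ∀ a' b', a ≤ a' → a' ≤ b' → b' ≤ b →
      ((∀ x ∈ Icc a' b', l * η ≤ g x) ∨ ∀ x ∈ Icc a' b', g x ≤ -(l * η)) →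
      ‖∫ x in a'..b', e x‖ ≤ B) :
    ‖∫ x in a..b, e x‖ ≤ 2 * η + 2 * B := by
  obtain ⟨c, hcI, hc1, hc2⟩ := exists_mul_dist_le hab hg hl
  obtain ⟨p, hp⟩ : ∃ p, p = max a (c - η) := ⟨_, rfl⟩
  obtain ⟨q, hq⟩ : ∃ q, q = min b (c + η) := ⟨_, rfl⟩
  have hap : a ≤ p := hp ▸ le_max_left _ _
  have hqb : q ≤ b := hq ▸ min_le_left _ _
  have hpc : p ≤ c := hp ▸ max_le hcI.1 (by linarith)
  have hcq : c ≤ q := hq ▸ le_min hcI.2 (by linarith)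
  have hpq := hpc.trans hcq
  have hi : ∀ u ∈ Icc a b, ∀ v ∈ Icc a b, IntervalIntegrable e volume u v := fun u hu v hv =>
    (he.mono (uIcc_subset_Icc hu hv)).intervalIntegrable
  have hpI : p ∈ Icc a b := ⟨hap, hpc.trans hcI.2⟩
  have hqI : q ∈ Icc a b := ⟨hcI.1.trans hcq, hqb⟩
  have haI := left_mem_Icc.2 hab
  have hbI := right_mem_Icc.2 hab
  rw [← intervalIntegral.integral_add_adjacent_intervals (hi a haI p hpI) (hi p hpI b hbI),
    ← intervalIntegral.integral_add_adjacent_intervals (hi p hpI q hqI) (hi q hqI b hbI)]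
  have h1 : ‖∫ x in a..p, e x‖ ≤ B := by
    rcases le_total a (c - η) with h | h
    · rw [max_eq_right h] at hp
      refine hB a p le_rfl hap (hpq.trans hqb) (Or.inr fun x hx => ?_)
      have := hc2 x ⟨hx.1, hx.2.trans hpI.2⟩ (by linarith [hx.2])
      nlinarith [hx.2]
    · rw [max_eq_left h] at hp
      simpa [hp] using hB0
  have h3 : ‖∫ x in q..b, e x‖ ≤ B := by
    rcases le_total b (c + η) with h | h
    · rw [min_eq_left h] at hq
      simpa [hq] using hB0
    · rw [min_eq_right h] at hq
      refine hB q b (hap.trans hpq) hqb le_rfl (Or.inl fun x hx => ?_)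
      have := hc1 x ⟨hqI.1.trans hx.1, hx.2⟩ (by linarith [hx.1])
      nlinarith [hx.1]
  have h2 : ‖∫ x in p..q, e x‖ ≤ 2 * η := by
    have := intervalIntegral.norm_integral_le_of_norm_le_const (a := p) (b := q) (f := e) (C := 1)
      fun x hx => by
        rw [uIoc_of_le hpq] at hx
        exact he1 x ⟨hap.trans hx.1.le, hx.2.trans hqb⟩
    rw [one_mul, abs_of_nonneg (sub_nonneg.2 hpq)] at this
    have h4 : c - η ≤ p := hp ▸ le_max_right _ _
    have h5 : q ≤ c + η := hq ▸ min_le_right _ _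
    linarith
  calc _ ≤ ‖∫ x in a..p, e x‖ + (‖∫ x in p..q, e x‖ + ‖∫ x in q..b, e x‖) :=
        (norm_add_le _ _).trans (by gcongr; exact norm_add_le _ _)
    _ ≤ _ := by linarith

/-- **Van der Corput's lemma** of order `k + 2`, for a phase with its jet `φ 0, φ 1, …`. -/
theorem exists_vanDerCorput (k : ℕ) : ∃ C : ℝ, 0 < C ∧ ∀ (φ : ℕ → ℝ → ℝ) (a b l : ℝ), a ≤ b →
    (∀ j, ∀ x ∈ Icc a b, HasDerivAt (φ j) (φ (j + 1) x) x) → 0 < l →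
    (∀ x ∈ Icc a b, l ≤ φ (k + 2) x) →
    ‖∫ x in a..b, phase (φ 0 x)‖ ≤ C * l ^ (-(1 / ((k : ℝ) + 2))) := by
  induction k with
  | zero =>
    refine ⟨10, by norm_num, fun φ a b l hab hφ hl hle => ?_⟩
    -- The radius l^{-1/2} balances 2η against the two outer terms 4/(lη); the constant is 10 = 2 +
    -- 2·4.
    have hη : 0 < l ^ (-(1 / 2) : ℝ) := Real.rpow_pos_of_pos hl _
    have hc : ∀ j, ContinuousOn (φ j) (Icc a b) := fun j x hx =>
      (hφ j x hx).continuousAt.continuousWithinAt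
    have hm : l * l ^ (-(1 / 2) : ℝ) * l ^ (-(1 / 2) : ℝ) = 1 := by
      rw [mul_assoc, ← Real.rpow_add hl]; norm_num [Real.rpow_neg_one, hl.ne']
    have h4 : 4 / (l * l ^ (-(1 / 2) : ℝ)) = 4 * l ^ (-(1 / 2) : ℝ) := by
      rw [div_eq_iff (by positivity)]; linear_combination (-4) * hm
    have := norm_integral_le_of_split (e := fun x => phase (φ 0 x)) (B := 4 * l ^ (-(1 / 2) : ℝ))
      hab (continuous_phase.comp_continuousOn (hc 0)) (fun x _ => (norm_phase _).le) (hφ 1) hl hle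
      hη (by positivity) fun a' b' ha hab' hb hor => by
        have hsub : Icc a' b' ⊆ Icc a b := Icc_subset_Icc ha hb
        rw [← h4]
        refine norm_integral_phase_le_of_le_abs_deriv hab' (fun x hx => hφ 0 x (hsub hx))
          (fun x hx => hφ 1 x (hsub hx)) ((hc 2).mono hsub)
          (fun x hx => hl.le.trans (hle x (hsub hx))) (by positivity) fun x hx => ?_
        rcases hor with h | h
        · exact (h x hx).trans (le_abs_self _)
        · have := h x hx
          exact le_trans (by linarith) (neg_le_abs _)
    norm_num at this ⊢
    linarith
  | succ k ih =>
    obtain ⟨C, hC, ih⟩ := ih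
    refine ⟨2 + 2 * C, by positivity, fun φ a b l hab hφ hl hle => ?_⟩
    obtain ⟨p, hp⟩ : ∃ p : ℝ, p = 1 / (((k + 1 : ℕ) : ℝ) + 2) := ⟨_, rfl⟩
    rw [← hp]
    have hη : 0 < l ^ (-p) := Real.rpow_pos_of_pos hl _
    have hc : ∀ j, ContinuousOn (φ j) (Icc a b) := fun j x hx =>
      (hφ j x hx).continuousAt.continuousWithinAt
    have hl' : 0 < l * l ^ (-p) := by positivity
    -- With p = 1/(k+3), the radius η = l^{-p} is the one for which the bound of order k+2 at the
    -- level lη is again a multiple of η. The constants then obey C ↦ 2 + 2C.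
    have hm : (l * l ^ (-p)) ^ (-(1 / ((k : ℝ) + 2))) = l ^ (-p) := by
      have h1 : l * l ^ (-p) = l ^ (1 - p) := by
        rw [sub_eq_add_neg, Real.rpow_add hl, Real.rpow_one]
      rw [h1, ← Real.rpow_mul hl.le]
      congr 1
      rw [hp]; push_cast; field_simp; ring
    have := norm_integral_le_of_split (e := fun x => phase (φ 0 x)) (B := C * l ^ (-p))
      hab (continuous_phase.comp_continuousOn (hc 0)) (fun x _ => (norm_phase _).le) (hφ (k + 2))
      hl hle hη (by positivity) fun a' b' ha hab' hb hor => by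
        have hsub : Icc a' b' ⊆ Icc a b := Icc_subset_Icc ha hb
        rw [← hm]
        rcases hor with h | h
        · exact ih φ a' b' _ hab' (fun j x hx => hφ j x (hsub hx)) hl' h
        · have := ih (fun j x => -φ j x) a' b' _ hab' (fun j x hx => (hφ j x (hsub hx)).neg) hl'
            fun x hx => by linarith [h x hx]
          rwa [norm_integral_phase_neg (φ 0)] at this
    linarith

/-- The lemma without amplitude holds on every [a, x] with the same constant, so it bounds the
primitive of the oscillating factor; integration by parts then brings in g. The constant depends on
the order alone. -/
theorem exists_vanDerCorput_amplitude (k : ℕ) : ∃ C : ℝ, 0 < C ∧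
    ∀ {E : Type} [NormedAddCommGroup E] [NormedSpace ℂ E] [CompleteSpace E]
      (φ : ℕ → ℝ → ℝ) (g g' : ℝ → E) (a b l G₀ G₁ : ℝ), a ≤ b →
    (∀ j x, HasDerivAt (φ j) (φ (j + 1) x) x) → 0 < l → (∀ x ∈ Icc a b, l ≤ |φ (k + 2) x|) →
    (∀ x ∈ Icc a b, HasDerivAt g (g' x) x) → ContinuousOn g' (Icc a b) →
    (∀ x ∈ Icc a b, ‖g x‖ ≤ G₀) → (∀ x ∈ Icc a b, ‖g' x‖ ≤ G₁) →
    ‖∫ x in a..b, phase (φ 0 x) • g x‖ ≤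
      C * l ^ (-(1 / ((k : ℝ) + 2))) * (2 * G₀ + (b - a) * G₁) := by
  obtain ⟨C, hC, h⟩ := exists_vanDerCorput k
  refine ⟨C, hC, fun {E} _ _ _ φ g g' a b l G₀ G₁ hab hφ hl hle hg hg' hG₀ hG₁ => ?_⟩
  have hφc : ∀ j, Continuous (φ j) := fun j =>
    continuous_iff_continuousAt.2 fun x => (hφ j x).continuousAt
  have hpc : Continuous fun x => phase (φ 0 x) := continuous_phase.comp (hφc 0)
  -- A continuous function bounded away from zero keeps its sign on an interval; the negative sign
  -- is reduced to the positive one by conjugation.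
  have hsign : (∀ x ∈ Icc a b, l ≤ φ (k + 2) x) ∨ ∀ x ∈ Icc a b, φ (k + 2) x ≤ -l := by
    by_contra! hcon
    obtain ⟨⟨x, hx, hx'⟩, y, hy, hy'⟩ := hcon
    have h1 : φ (k + 2) x ≤ 0 := by
      rcases le_abs.1 (hle x hx) with h | h <;> linarith
    have h2 : 0 ≤ φ (k + 2) y := by
      rcases le_abs.1 (hle y hy) with h | h <;> linarith
    obtain ⟨z, hz, hz0⟩ := isPreconnected_Icc.intermediate_value hx hy
      (hφc (k + 2)).continuousOn ⟨h1, h2⟩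
    have := hle z hz
    rw [hz0, abs_zero] at this
    linarith
  refine norm_integral_smul_le_of_hasDerivAt (F := fun x => ∫ t in a..x, phase (φ 0 t)) hab
    (fun x _ => intervalIntegral.integral_hasDerivAt_right (hpc.intervalIntegrable _ _)
      (hpc.stronglyMeasurableAtFilter _ _) hpc.continuousAt) hpc.continuousOn
    (fun x hx => ?_) hg hg' hG₀ hG₁
  have hsub : Icc a x ⊆ Icc a b := Icc_subset_Icc le_rfl hx.2
  rcases hsign with hs | hs
  · exact h φ a x l hx.1 (fun j y _ => hφ j y) hl fun y hy => hs y (hsub hy)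
  · have := h (fun j x => -φ j x) a x l hx.1 (fun j y _ => (hφ j y).neg) hl
      fun y hy => by linarith [hs y (hsub hy)]
    rwa [norm_integral_phase_neg (φ 0)] at this

/-! ### The quintic Fresnel integral -/

/-- The incomplete quintic Fresnel integral `∫₀ᵀ e^{it⁵} dt`. -/
def quinticIntegral (T : ℝ) : ℂ := ∫ t in (0 : ℝ)..T, phase (t ^ 5)

theorem continuous_phase_pow : Continuous fun t : ℝ => phase (t ^ 5) := by fun_prop

theorem hasDerivAt_quinticIntegral (T : ℝ) :
    HasDerivAt quinticIntegral (phase (T ^ 5)) T :=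
  intervalIntegral.integral_hasDerivAt_right (continuous_phase_pow.intervalIntegrable _ _)
    (continuous_phase_pow.stronglyMeasurableAtFilter _ _) continuous_phase_pow.continuousAt

theorem norm_quinticIntegral_sub_le {S T : ℝ} (hT : 0 < T) (h : T ≤ S) :
    ‖quinticIntegral S - quinticIntegral T‖ ≤ 4 / (5 * T ^ 4) := by
  have hi : ∀ a b : ℝ, IntervalIntegrable (fun t => phase (t ^ 5)) volume a b := fun a b =>
    continuous_phase_pow.intervalIntegrable a b
  rw [quinticIntegral, quinticIntegral,
    intervalIntegral.integral_interval_sub_left (hi _ _) (hi _ _)]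
  refine norm_integral_phase_le_of_le_abs_deriv (φ' := fun t => 5 * t ^ 4)
    (φ'' := fun t => 20 * t ^ 3) h (fun x _ => ?_) (fun x _ => ?_) (by fun_prop) (fun x hx => ?_)
    (by positivity) fun x hx => ?_
  · simpa using hasDerivAt_pow 5 x
  · have := (hasDerivAt_pow 4 x).const_mul 5
    refine this.congr_deriv ?_
    norm_num; ring
  · have : 0 < x := hT.trans_le hx.1
    positivity
  · have : 0 < x := hT.trans_le hx.1
    rw [abs_of_nonneg (by positivity)]
    have := hx.1
    gcongr

/-- Since t⁵ is odd, a limit Λ at +∞ forces the limit -conj Λ at -∞. The integral over the whole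
line is therefore the real number 2 Re Λ. -/
theorem quinticIntegral_neg (T : ℝ) :
    quinticIntegral (-T) = -starRingEnd ℂ (quinticIntegral T) := by
  have h := intervalIntegral.integral_comp_neg (a := 0) (b := T) fun t : ℝ => phase (t ^ 5)
  rw [neg_zero] at h
  rw [quinticIntegral, quinticIntegral, ← intervalIntegral.intervalIntegral_conj,
    intervalIntegral.integral_symm, ← h]
  simp only [← phase_neg]
  congr 2; ext t; congr 1; ring

theorem norm_quinticIntegral_le {T : ℝ} (hT : 0 ≤ T) : ‖quinticIntegral T‖ ≤ T := by
  have := intervalIntegral.norm_integral_le_of_norm_le_const (a := 0) (b := T)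
    (f := fun t : ℝ => phase (t ^ 5)) (C := 1) fun x _ => (norm_phase _).le
  rwa [sub_zero, one_mul, abs_of_nonneg hT] at this

/-- From cos u ≥ 1 - u²/2. The value 21/22 exceeds the bound 4/5 for the tail beyond 1, which makes
Re Λ positive. -/
theorem re_quinticIntegral_one : 21 / 22 ≤ (quinticIntegral 1).re := by
  have h1 : (quinticIntegral 1).re = ∫ t in (0 : ℝ)..1, Real.cos (t ^ 5) := by
    have := Complex.reCLM.intervalIntegral_comp_comm
      (continuous_phase_pow.intervalIntegrable (μ := volume) 0 1)
    simp only [Complex.reCLM_apply] at this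
    rw [quinticIntegral, ← this]
    refine intervalIntegral.integral_congr fun t _ => ?_
    simp only [phase_eq, Complex.add_re, Complex.ofReal_re, Complex.mul_re, Complex.ofReal_im,
      Complex.I_re, Complex.I_im]
    ring
  have h2 : (∫ t in (0 : ℝ)..1, (1 - t ^ 10 / 2)) = 21 / 22 := by
    rw [intervalIntegral.integral_sub (by simp) (by
      exact (by fun_prop : Continuous fun t : ℝ => t ^ 10 / 2).intervalIntegrable _ _)]
    rw [intervalIntegral.integral_div, integral_pow]
    norm_num
  rw [h1, ← h2]
  refine intervalIntegral.integral_mono_on zero_le_one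
    ((by fun_prop : Continuous fun t : ℝ => 1 - t ^ 10 / 2).intervalIntegrable _ _)
    ((by fun_prop : Continuous fun t : ℝ => Real.cos (t ^ 5)).intervalIntegrable _ _)
    fun x _ => ?_
  have := Real.one_sub_sq_div_two_le_cos (x := x ^ 5)
  calc 1 - x ^ 10 / 2 = 1 - (x ^ 5) ^ 2 / 2 := by ring
    _ ≤ _ := this

/-- The tail bound 4/(5T⁴) gives convergence. It is weakened to C/(1 + T²), which is valid down to T
= 0 and has an arctangent as primitive. -/
theorem exists_quinticIntegral_limit : ∃ Λ : ℂ, 0 < Λ.re ∧ ∃ C : ℝ, 0 < C ∧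
    ∀ T : ℝ, 0 ≤ T → ‖quinticIntegral T - Λ‖ ≤ C / (1 + T ^ 2) := by
  -- The shift by one avoids T = 0, where the tail bound is not available.
  have hcau : CauchySeq fun n : ℕ => quinticIntegral (n + 1) := by
    refine cauchySeq_of_le_tendsto_0' (fun n : ℕ => 4 / (5 * ((n : ℝ) + 1) ^ 4))
      (fun n m hnm => ?_) ?_
    · rw [dist_comm, dist_eq_norm]
      refine norm_quinticIntegral_sub_le (by positivity) ?_
      have : (n : ℝ) ≤ m := by exact_mod_cast hnm
      linarith
    · refine Filter.Tendsto.const_div_atTop (Filter.Tendsto.const_mul_atTop (by norm_num) ?_) _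
      exact (tendsto_pow_atTop (by norm_num)).comp
        (tendsto_atTop_add_const_right _ _ tendsto_natCast_atTop_atTop)
  obtain ⟨Λ, hΛ⟩ := cauchySeq_tendsto_of_complete hcau
  have hlim : ∀ T : ℝ, 0 < T → ‖quinticIntegral T - Λ‖ ≤ 4 / (5 * T ^ 4) := fun T hT => by
    rw [norm_sub_rev]
    refine le_of_tendsto ((hΛ.sub_const _).norm) ?_
    filter_upwards [eventually_ge_atTop ⌈T⌉₊] with n hn
    refine norm_quinticIntegral_sub_le hT ?_
    have h1 : ((⌈T⌉₊ : ℕ) : ℝ) ≤ n := by exact_mod_cast hn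
    linarith [Nat.le_ceil T]
  refine ⟨Λ, ?_, 2 * (1 + ‖Λ‖), by positivity, fun T hT => ?_⟩
  · have h1 := hlim 1 one_pos
    have h2 := (Complex.abs_re_le_norm _).trans h1
    have h3 := re_quinticIntegral_one
    rw [Complex.sub_re] at h2
    have := (abs_le.1 h2).2
    norm_num at this
    linarith
  · rw [le_div_iff₀ (by positivity)]
    rcases le_total T 1 with h | h
    · have h1 : ‖quinticIntegral T - Λ‖ ≤ 1 + ‖Λ‖ :=
        (norm_sub_le _ _).trans (by gcongr; exact (norm_quinticIntegral_le hT).trans h)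
      have h2 : 1 + T ^ 2 ≤ 2 := by nlinarith
      calc _ ≤ (1 + ‖Λ‖) * 2 := by gcongr
        _ = _ := by ring
    · have h1 := hlim T (by linarith)
      have h3 : 1 ≤ T ^ 2 := by nlinarith
      have h2 : 4 / (5 * T ^ 4) * (1 + T ^ 2) ≤ 2 := by
        rw [div_mul_eq_mul_div, div_le_iff₀ (by positivity)]
        nlinarith
      calc _ ≤ 4 / (5 * T ^ 4) * (1 + T ^ 2) := by gcongr
        _ ≤ 2 := h2
        _ ≤ _ := by linarith [norm_nonneg Λ]

/-! ### Degenerate stationary phase -/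

section

variable {E : Type*} [NormedAddCommGroup E] [NormedSpace ℂ E] [CompleteSpace E]

/-- The function F = (`quinticIntegral` (r y) - Λ) / r is a primitive of e^{i(ry)⁵} y'. Integration
by parts leaves the main term -F(0) v(0) = (Λ/r) v(0). The boundary term at δ and the integral of F
v' are O(r⁻²), as F decays on the scale 1/r. Asking for the limit Λ only along the values r y(x)
covers both signs of y. -/
theorem exists_half_quintic_expansion {y y' : ℝ → ℝ} {v v' : ℝ → E} {δ c C : ℝ} {Λ : ℂ}
    (hδ : 0 < δ) (hc : 0 < c) (hC : 0 < C)
    (hΛ : ∀ r : ℝ, 1 ≤ r → ∀ x ∈ Ioc 0 δ,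
      ‖quinticIntegral (r * y x) - Λ‖ ≤ C / (1 + (r * y x) ^ 2))
    (hy0 : y 0 = 0) (hy : ∀ x ∈ Icc 0 δ, HasDerivAt y (y' x) x)
    (hy' : ContinuousOn y' (Icc 0 δ)) (hcy : ∀ x ∈ Icc 0 δ, c * x ≤ |y x|)
    (hv : ∀ x ∈ Icc 0 δ, HasDerivAt v (v' x) x) (hv' : ContinuousOn v' (Icc 0 δ)) :
    ∃ K : ℝ, ∀ r : ℝ, 1 ≤ r →
      ‖(∫ x in (0 : ℝ)..δ, phase ((r * y x) ^ 5) • ((y' x : ℂ) • v x)) - (Λ / r) • v 0‖ ≤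
        K / r ^ 2 := by
  obtain ⟨V, hV⟩ := isCompact_Icc.exists_bound_of_continuousOn hv'
  have h0I : (0 : ℝ) ∈ Icc 0 δ := left_mem_Icc.2 hδ.le
  have hδI : δ ∈ Icc 0 δ := right_mem_Icc.2 hδ.le
  have hV0 : 0 ≤ V := (norm_nonneg _).trans (hV 0 h0I)
  refine ⟨C / (c * δ) * ‖v δ‖ + 2 * V * C / c, fun r hr => ?_⟩
  have hr0 : 0 < r := by linarith
  have hrC : (r : ℂ) ≠ 0 := by exact_mod_cast hr0.ne'
  have hyc : ContinuousOn y (Icc 0 δ) := fun x hx => (hy x hx).continuousAt.continuousWithinAt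
  have hvc : ContinuousOn v (Icc 0 δ) := fun x hx => (hv x hx).continuousAt.continuousWithinAt
  set F : ℝ → ℂ := fun x => (quinticIntegral (r * y x) - Λ) / r with hF
  have hFd : ∀ x ∈ Icc 0 δ, HasDerivAt F (phase ((r * y x) ^ 5) * y' x) x := fun x hx => by
    have h1 : HasDerivAt (fun x => r * y x) (r * y' x) x := (hy x hx).const_mul r
    have h2 := ((hasDerivAt_quinticIntegral (r * y x)).scomp x h1).sub_const Λ |>.div_const (r : ℂ)
    refine h2.congr_deriv ?_
    rw [Complex.real_smul]; push_cast; field_simp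
  have hFb : ∀ x ∈ Ioc 0 δ, ‖F x‖ ≤ C / (r * (1 + (r * (c * x)) ^ 2)) := fun x hx => by
    have h1 := hΛ r hr x hx
    have h2 := hcy x (Ioc_subset_Icc_self hx)
    have h0 : 0 ≤ r * (c * x) := by have := hx.1; positivity
    have h3 : (r * (c * x)) ^ 2 ≤ (r * y x) ^ 2 := by
      rw [← sq_abs (r * y x), abs_mul, abs_of_pos hr0]
      gcongr
    rw [hF, norm_div, Complex.norm_real, Real.norm_eq_abs, abs_of_pos hr0,
      mul_comm r (1 + _), ← div_div]
    exact div_le_div_of_nonneg_right (h1.trans (by gcongr)) hr0.le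
  have hFc : ContinuousOn F (Icc 0 δ) := fun x hx => (hFd x hx).continuousAt.continuousWithinAt
  have hec : ContinuousOn (fun x => phase ((r * y x) ^ 5) * (y' x : ℂ)) (Icc 0 δ) :=
    (continuous_phase_pow.comp_continuousOn (continuousOn_const.mul hyc)).mul
      (Complex.continuous_ofReal.comp_continuousOn hy')
  have hu : uIcc 0 δ = Icc 0 δ := uIcc_of_le hδ.le
  have hm : ∀ x, x ∈ Ioo (min 0 δ) (max 0 δ) → x ∈ Icc 0 δ := fun x hx => by
    rw [min_eq_left hδ.le, max_eq_right hδ.le] at hx; exact Ioo_subset_Icc_self hx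
  rw [← hu] at hFc hec hvc hv'
  have key := intervalIntegral.integral_deriv_smul_eq_sub_of_hasDeriv_right (𝕜 := ℂ) hFc hvc
    (fun x hx => (hFd x (hm x hx)).hasDerivWithinAt)
    (fun x hx => (hv x (hm x hx)).hasDerivWithinAt)
    hec.intervalIntegrable hv'.intervalIntegrable
  have hi1 : IntervalIntegrable (fun x => (phase ((r * y x) ^ 5) * (y' x : ℂ)) • v x) volume 0 δ :=
    (hec.smul hvc).intervalIntegrable
  have hi2 : IntervalIntegrable (fun x => F x • v' x) volume 0 δ :=
    (hFc.smul hv').intervalIntegrable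
  rw [intervalIntegral.integral_add hi1 hi2] at key
  have e1 : (∫ x in (0 : ℝ)..δ, phase ((r * y x) ^ 5) • ((y' x : ℂ) • v x)) - (Λ / r) • v 0 =
      F δ • v δ - ∫ x in (0 : ℝ)..δ, F x • v' x := by
    simp only [smul_smul]
    rw [eq_sub_of_add_eq key]
    have : F 0 = -(Λ / r) := by simp [hF, hy0, quinticIntegral, neg_div]
    rw [this, neg_smul]; abel
  have b1 : ‖F δ • v δ‖ ≤ C / (c * δ) * ‖v δ‖ / r ^ 2 := by
    rw [norm_smul]
    have h1 := hFb δ ⟨hδ, le_rfl⟩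
    have h2 : C / (r * (1 + (r * (c * δ)) ^ 2)) ≤ C / (r * (r * (c * δ))) := by
      have : r * (c * δ) ≤ 1 + (r * (c * δ)) ^ 2 := by nlinarith [sq_nonneg (r * (c * δ) - 1)]
      gcongr
    calc _ ≤ C / (r * (r * (c * δ))) * ‖v δ‖ := by gcongr; exact h1.trans h2
      _ = _ := by field_simp
  -- Explicit primitive of the majorant of F v'; it gains a second factor 1/r because the arctangent
  -- is bounded.
  have hd : ∀ x : ℝ, HasDerivAt (fun x => V * C / (r * (r * c)) * Real.arctan (r * c * x))
      (V * (C / (r * (1 + (r * (c * x)) ^ 2)))) x := fun x => by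
    have := (((hasDerivAt_id x).const_mul (r * c)).arctan).const_mul (V * C / (r * (r * c)))
    refine this.congr_deriv ?_
    have : 1 + (r * (c * x)) ^ 2 ≠ 0 := by positivity
    have h' : 1 + (r * c * x) ^ 2 ≠ 0 := by positivity
    simp only [id, mul_one]
    field_simp
  have hdc : Continuous fun x : ℝ => V * (C / (r * (1 + (r * (c * x)) ^ 2))) := by
    refine continuous_const.mul (continuous_const.div (by fun_prop) fun x => by positivity)
  have b2 : ‖∫ x in (0 : ℝ)..δ, F x • v' x‖ ≤ 2 * V * C / c / r ^ 2 := by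
    have h1 := intervalIntegral.norm_integral_le_of_norm_le (μ := volume) hδ.le
      (f := fun x => F x • v' x) (g := fun x => V * (C / (r * (1 + (r * (c * x)) ^ 2))))
      (Filter.Eventually.of_forall fun x hx => by
        rw [norm_smul, mul_comm]
        have h3 := hV x (Ioc_subset_Icc_self hx)
        have h4 := hFb x hx
        gcongr) (hdc.intervalIntegrable _ _)
    rw [intervalIntegral.integral_eq_sub_of_hasDerivAt (fun x _ => hd x)
      (hdc.intervalIntegrable _ _)] at h1
    have h2 : Real.arctan (r * c * δ) ≤ 2 :=
      (Real.arctan_lt_pi_div_two _).le.trans (by linarith [Real.pi_le_four])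
    simp only [mul_zero, Real.arctan_zero, sub_zero] at h1
    calc _ ≤ V * C / (r * (r * c)) * 2 := h1.trans (by gcongr)
      _ = _ := by field_simp
  rw [e1, add_div]
  exact (norm_sub_le _ _).trans (add_le_add b1 b2)

/-- The half-line expansion is applied on both sides of 0. The two ends of the line contribute
limits whose difference is ±2 Re Λ, with the sign σ telling whether y increases or decreases through
0. -/
theorem exists_quintic_expansion {y y' : ℝ → ℝ} {v v' : ℝ → E} {δ c C σ : ℝ} {Λ : ℂ}
    (hδ : 0 < δ) (hc : 0 < c) (hC : 0 < C)
    (hΛ : ∀ T : ℝ, 0 ≤ T → ‖quinticIntegral T - Λ‖ ≤ C / (1 + T ^ 2))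
    (hy0 : y 0 = 0) (hy : ∀ x ∈ Icc (-δ) δ, HasDerivAt y (y' x) x)
    (hy' : ContinuousOn y' (Icc (-δ) δ)) (hcy : ∀ x ∈ Icc (-δ) δ, c * |x| ≤ |y x|)
    (hσ : σ = 1 ∨ σ = -1) (hsign : ∀ x ∈ Icc (-δ) δ, 0 ≤ σ * (x * y x))
    (hv : ∀ x ∈ Icc (-δ) δ, HasDerivAt v (v' x) x) (hv' : ContinuousOn v' (Icc (-δ) δ)) :
    ∃ K : ℝ, ∀ r : ℝ, 1 ≤ r →
      ‖(∫ x in (-δ)..δ, phase ((r * y x) ^ 5) • ((y' x : ℂ) • v x)) -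
        ((σ * (2 * Λ.re) / r : ℝ) : ℂ) • v 0‖ ≤ K / r ^ 2 := by
  have hΛ' : ∀ T : ℝ, T ≤ 0 →
      ‖quinticIntegral T - -starRingEnd ℂ Λ‖ ≤ C / (1 + T ^ 2) := fun T hT => by
    have := hΛ (-T) (by linarith)
    rw [neg_sq, quinticIntegral_neg, ← RCLike.norm_conj, ← norm_neg] at this
    refine le_of_eq_of_le (congrArg norm ?_) this
    simp only [map_sub, map_neg, Complex.conj_conj]; ring
  -- Λ₁ is the limit seen from x > 0 and Λ₂ the one seen from x < 0.
  obtain ⟨Λ₁, Λ₂, hd, hΛ₁, hΛ₂⟩ : ∃ Λ₁ Λ₂ : ℂ, Λ₁ - Λ₂ = (σ * (2 * Λ.re) : ℝ) ∧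
      (∀ T : ℝ, 0 ≤ σ * T → ‖quinticIntegral T - Λ₁‖ ≤ C / (1 + T ^ 2)) ∧
      ∀ T : ℝ, σ * T ≤ 0 → ‖quinticIntegral T - Λ₂‖ ≤ C / (1 + T ^ 2) := by
    rcases hσ with rfl | rfl
    · refine ⟨Λ, -starRingEnd ℂ Λ, ?_, fun T hT => hΛ T (by linarith),
        fun T hT => hΛ' T (by linarith)⟩
      rw [sub_neg_eq_add, Complex.add_conj, one_mul]
    · refine ⟨-starRingEnd ℂ Λ, Λ, ?_, fun T hT => hΛ' T (by linarith),
        fun T hT => hΛ T (by linarith)⟩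
      rw [← neg_add', add_comm, Complex.add_conj]; push_cast; ring
  have hr : Icc 0 δ ⊆ Icc (-δ) δ := Icc_subset_Icc (by linarith) le_rfl
  have hl : ∀ x ∈ Icc 0 δ, -x ∈ Icc (-δ) δ := fun x hx => ⟨by linarith [hx.2], by linarith [hx.1]⟩
  have hneg : ContinuousOn (fun x : ℝ => -x) (Icc 0 δ) := by fun_prop
  obtain ⟨K₁, h1⟩ := exists_half_quintic_expansion (Λ := Λ₁) hδ hc hC (fun r hr1 x hx => hΛ₁ _ (by
      have h1 := hsign x (hr (Ioc_subset_Icc_self hx))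
      have h2 : 0 ≤ σ * y x := by
        refine nonneg_of_mul_nonneg_right (b := σ * y x) (a := x) ?_ hx.1
        linarith [mul_left_comm σ x (y x)]
      have := mul_nonneg (zero_le_one.trans hr1) h2
      linarith [mul_left_comm σ r (y x)])) hy0 (fun x hx => hy x (hr hx)) (hy'.mono hr)
      (fun x hx => by simpa [abs_of_nonneg hx.1] using hcy x (hr hx))
      (fun x hx => hv x (hr hx)) (hv'.mono hr)
  obtain ⟨K₂, h2⟩ := exists_half_quintic_expansion (Λ := Λ₂) (y := fun x => y (-x))
      (y' := fun x => -y' (-x)) (v := fun x => v (-x)) (v' := fun x => -v' (-x)) hδ hc hC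
      (fun r hr1 x hx => hΛ₂ _ (by
      have h1 := hsign (-x) (hl x (Ioc_subset_Icc_self hx))
      have h2 : 0 ≤ -(σ * y (-x)) := by
        refine nonneg_of_mul_nonneg_right (b := -(σ * y (-x))) (a := x) ?_ hx.1
        linarith [mul_left_comm σ x (y (-x))]
      have := mul_nonneg (zero_le_one.trans hr1) h2
      linarith [mul_left_comm σ r (y (-x))])) (by simpa using hy0)
      (fun x hx => by
        have := (hy (-x) (hl x hx)).comp x (hasDerivAt_neg x)
        exact this.congr_deriv (by ring))
      ((hy'.comp hneg hl).neg)
      (fun x hx => by simpa [abs_of_nonneg hx.1] using hcy (-x) (hl x hx))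
      (fun x hx => by
        have := (hv (-x) (hl x hx)).scomp x (hasDerivAt_neg x)
        exact this.congr_deriv (by rw [neg_smul, one_smul])) ((hv'.comp hneg hl).neg)
  refine ⟨K₁ + K₂, fun r hr1 => ?_⟩
  have h1 := h1 r hr1
  have h2 := h2 r hr1
  have hyc : ContinuousOn y (Icc (-δ) δ) := fun x hx => (hy x hx).continuousAt.continuousWithinAt
  have hvc : ContinuousOn v (Icc (-δ) δ) := fun x hx => (hv x hx).continuousAt.continuousWithinAt
  have hcont : ContinuousOn (fun x => phase ((r * y x) ^ 5) • ((y' x : ℂ) • v x)) (Icc (-δ) δ) :=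
    (continuous_phase_pow.comp_continuousOn (continuousOn_const.mul hyc)).smul
      ((Complex.continuous_ofReal.comp_continuousOn hy').smul hvc)
  have h0 : (0 : ℝ) ∈ Icc (-δ) δ := ⟨by linarith, hδ.le⟩
  rw [← intervalIntegral.integral_add_adjacent_intervals (b := 0)
    (hcont.mono (uIcc_subset_Icc ⟨le_rfl, by linarith⟩ h0)).intervalIntegrable
    (hcont.mono (uIcc_subset_Icc h0 ⟨by linarith, le_rfl⟩)).intervalIntegrable]
  have hflip := intervalIntegral.integral_comp_neg (a := 0) (b := δ)
    fun x => phase ((r * y x) ^ 5) • ((y' x : ℂ) • v x)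
  rw [neg_zero] at hflip
  have e2 : (∫ x in (0 : ℝ)..δ, phase ((r * y (-x)) ^ 5) • (((-y' (-x) : ℝ) : ℂ) • v (-x))) =
      -∫ x in (-δ)..0, phase ((r * y x) ^ 5) • ((y' x : ℂ) • v x) := by
    rw [← hflip, ← intervalIntegral.integral_neg]
    refine intervalIntegral.integral_congr fun x _ => ?_
    simp
  rw [e2, neg_zero] at h2
  rw [Complex.ofReal_div, ← hd, add_div]
  refine le_trans (le_of_eq_of_le (congrArg norm ?_) (norm_sub_le _ _)) (add_le_add h1 h2)
  rw [sub_div, sub_smul]; abel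

end

/-! ### The dispersion relation -/

/-- `sin ω / ω`. -/
def sincOmega (m ξ : ℝ) : ℝ := Real.sin (omega m ξ) / omega m ξ

section

variable {m : ℝ}

theorem omega_arg_pos (hm : 0 < m) (ξ : ℝ) : 0 < m ^ 2 + ξ ^ 2 := by positivity

theorem omega_pos (hm : 0 < m) (ξ : ℝ) : 0 < omega m ξ := Real.sqrt_pos.2 (omega_arg_pos hm ξ)

theorem omega_sq (hm : 0 < m) (ξ : ℝ) : omega m ξ ^ 2 = m ^ 2 + ξ ^ 2 :=
  Real.sq_sqrt (omega_arg_pos hm ξ).le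

theorem contDiff_omega (hm : 0 < m) : ContDiff ℝ ω (omega m) :=
  ContDiff.sqrt (by fun_prop) fun ξ => (omega_arg_pos hm ξ).ne'

theorem contDiff_real_sin : ContDiff ℝ ω Real.sin := Real.analyticOnNhd_sin.contDiff

theorem contDiff_real_cos : ContDiff ℝ ω Real.cos := Real.analyticOnNhd_cos.contDiff

theorem contDiff_sincOmega (hm : 0 < m) : ContDiff ℝ ω (sincOmega m) :=
  (contDiff_real_sin.comp (contDiff_omega hm)).div (contDiff_omega hm)
    fun ξ => (omega_pos hm ξ).ne'

theorem theta_arg_pos (hm : 0 < m) (ξ : ℝ) :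
    0 < m ^ 2 + ξ ^ 2 * Real.cos (omega m ξ) ^ 2 := by positivity

theorem contDiff_theta (hm : 0 < m) : ContDiff ℝ ω (theta m) := by
  have ho := contDiff_omega hm
  have harctan : ContDiff ℝ ω Real.arctan := Real.contDiff_arctan
  refine harctan.comp (ContDiff.div (contDiff_id.mul (contDiff_real_sin.comp ho))
    (ContDiff.sqrt ?_ fun ξ => (theta_arg_pos hm ξ).ne')
    fun ξ => (Real.sqrt_pos.2 (theta_arg_pos hm ξ)).ne')
  exact contDiff_const.add ((contDiff_id.pow 2).mul ((contDiff_real_cos.comp ho).pow 2))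

theorem theta_zero (m : ℝ) : theta m 0 = 0 := by simp [theta]

theorem sqrt_one_add_theta_arg (hm : 0 < m) (ξ : ℝ) :
    Real.sqrt (1 + (ξ * Real.sin (omega m ξ) /
      Real.sqrt (m ^ 2 + ξ ^ 2 * Real.cos (omega m ξ) ^ 2)) ^ 2) =
    omega m ξ / Real.sqrt (m ^ 2 + ξ ^ 2 * Real.cos (omega m ξ) ^ 2) := by
  have h1 := theta_arg_pos hm ξ
  have h2 := Real.sqrt_pos.2 h1
  rw [Real.sqrt_eq_iff_mul_self_eq (by positivity) (by have := omega_pos hm ξ; positivity),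
    ← sq, div_pow, div_pow, Real.sq_sqrt h1.le, omega_sq hm]
  field_simp
  linear_combination ξ ^ 2 * Real.sin_sq_add_cos_sq (omega m ξ)

theorem cos_theta (hm : 0 < m) (ξ : ℝ) : Real.cos (theta m ξ) =
    Real.sqrt (m ^ 2 + ξ ^ 2 * Real.cos (omega m ξ) ^ 2) / omega m ξ := by
  rw [theta, Real.cos_arctan, sqrt_one_add_theta_arg hm, one_div, inv_div]

/-- The derivatives of θ at zero are computed by differentiating this relation instead of the
arctangent. -/
theorem sin_theta (hm : 0 < m) (ξ : ℝ) : Real.sin (theta m ξ) = ξ * sincOmega m ξ := by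
  have h2 := Real.sqrt_pos.2 (theta_arg_pos hm ξ)
  rw [theta, Real.sin_arctan, sqrt_one_add_theta_arg hm, sincOmega]
  have := omega_pos hm ξ
  field_simp

theorem cos_theta_pos (hm : 0 < m) (ξ : ℝ) : 0 < Real.cos (theta m ξ) := by
  rw [cos_theta hm]
  exact div_pos (Real.sqrt_pos.2 (theta_arg_pos hm ξ)) (omega_pos hm ξ)

theorem cos_theta_sq (hm : 0 < m) (ξ : ℝ) : Real.cos (theta m ξ) ^ 2 =
    Real.cos (omega m ξ) ^ 2 + (sincOmega m ξ * m) ^ 2 := by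
  rw [cos_theta hm, div_pow, Real.sq_sqrt (theta_arg_pos hm ξ).le, sincOmega]
  have := omega_pos hm ξ
  field_simp
  rw [omega_sq hm]
  linear_combination (-m ^ 2) * Real.sin_sq_add_cos_sq (omega m ξ)

/-! ### The derivatives of the dispersion relation at zero -/

theorem hasDerivAt_omega (hm : 0 < m) (ξ : ℝ) : HasDerivAt (omega m) (ξ / omega m ξ) ξ := by
  have h := ((hasDerivAt_pow 2 ξ).const_add (m ^ 2)).sqrt (omega_arg_pos hm ξ).ne'
  refine h.congr_deriv ?_
  have := omega_pos hm ξ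
  rw [← omega]
  field_simp
  norm_num

theorem hasDerivAt_cos_omega (hm : 0 < m) (ξ : ℝ) :
    HasDerivAt (fun ξ => Real.cos (omega m ξ)) (-(ξ * sincOmega m ξ)) ξ := by
  refine (hasDerivAt_omega hm ξ).cos.congr_deriv ?_
  rw [sincOmega]; ring

/-- The derivative of `sin ω / ω`, divided by `ξ`. -/
def sincOmega₁ (m ξ : ℝ) : ℝ := (Real.cos (omega m ξ) - sincOmega m ξ) / (m ^ 2 + ξ ^ 2)

/-- The derivative of `-sincOmega₁ m`, divided by `ξ`. -/
def sincOmega₂ (m ξ : ℝ) : ℝ := (sincOmega m ξ + 3 * sincOmega₁ m ξ) / (m ^ 2 + ξ ^ 2)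

/-- The derivative of `sincOmega₂ m`, divided by `ξ`. -/
def sincOmega₃ (m ξ : ℝ) : ℝ := (sincOmega₁ m ξ - 5 * sincOmega₂ m ξ) / (m ^ 2 + ξ ^ 2)

/-- The derivative of `-sincOmega₃ m`, divided by `ξ`. -/
def sincOmega₄ (m ξ : ℝ) : ℝ := (sincOmega₂ m ξ + 7 * sincOmega₃ m ξ) / (m ^ 2 + ξ ^ 2)

theorem hasDerivAt_sincOmega (hm : 0 < m) (ξ : ℝ) :
    HasDerivAt (sincOmega m) (ξ * sincOmega₁ m ξ) ξ := by
  have h := omega_pos hm ξ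
  refine ((hasDerivAt_omega hm ξ).sin.div (hasDerivAt_omega hm ξ) h.ne').congr_deriv ?_
  rw [sincOmega₁, ← omega_sq hm, sincOmega]
  field_simp

/-- The quotient reappears in its own derivative; this is what closes the recursion for
`sincOmega₁`, …, `sincOmega₄`. -/
theorem hasDerivAt_div_omega_arg (hm : 0 < m) {g : ℝ → ℝ} {g' ξ : ℝ} (hg : HasDerivAt g g' ξ) :
    HasDerivAt (fun ξ => g ξ / (m ^ 2 + ξ ^ 2))
      ((g' - 2 * ξ * (g ξ / (m ^ 2 + ξ ^ 2))) / (m ^ 2 + ξ ^ 2)) ξ := by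
  have h := omega_arg_pos hm ξ
  refine (hg.div ((hasDerivAt_pow 2 ξ).const_add (m ^ 2)) h.ne').congr_deriv ?_
  field_simp
  ring

theorem hasDerivAt_sincOmega₁ (hm : 0 < m) (ξ : ℝ) :
    HasDerivAt (sincOmega₁ m) (-(ξ * sincOmega₂ m ξ)) ξ := by
  refine (hasDerivAt_div_omega_arg hm
    ((hasDerivAt_cos_omega hm ξ).sub (hasDerivAt_sincOmega hm ξ))).congr_deriv ?_
  change (_ - 2 * ξ * sincOmega₁ m ξ) / _ = _
  rw [sincOmega₂]; ring

theorem hasDerivAt_sincOmega₂ (hm : 0 < m) (ξ : ℝ) :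
    HasDerivAt (sincOmega₂ m) (ξ * sincOmega₃ m ξ) ξ := by
  refine (hasDerivAt_div_omega_arg hm ((hasDerivAt_sincOmega hm ξ).add
    ((hasDerivAt_sincOmega₁ hm ξ).const_mul 3))).congr_deriv ?_
  change (_ - 2 * ξ * sincOmega₂ m ξ) / _ = _
  rw [sincOmega₃]; ring

theorem hasDerivAt_sincOmega₃ (hm : 0 < m) (ξ : ℝ) :
    HasDerivAt (sincOmega₃ m) (-(ξ * sincOmega₄ m ξ)) ξ := by
  refine (hasDerivAt_div_omega_arg hm ((hasDerivAt_sincOmega₁ hm ξ).sub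
    ((hasDerivAt_sincOmega₂ hm ξ).const_mul 5))).congr_deriv ?_
  change (_ - 2 * ξ * sincOmega₃ m ξ) / _ = _
  rw [sincOmega₄]; ring

theorem continuous_sincOmega₄ (hm : 0 < m) : Continuous (sincOmega₄ m) := by
  have h2 : Continuous (sincOmega₂ m) :=
    continuous_iff_continuousAt.2 fun ξ => (hasDerivAt_sincOmega₂ hm ξ).continuousAt
  have h3 : Continuous (sincOmega₃ m) :=
    continuous_iff_continuousAt.2 fun ξ => (hasDerivAt_sincOmega₃ hm ξ).continuousAt
  exact (h2.add (h3.const_mul 7)).div (by fun_prop) fun ξ => (omega_arg_pos hm ξ).ne'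

theorem hasDerivAt_iteratedDeriv_theta (hm : 0 < m) (j : ℕ) (ξ : ℝ) :
    HasDerivAt (iteratedDeriv j (theta m)) (iteratedDeriv (j + 1) (theta m) ξ) ξ := by
  rw [iteratedDeriv_succ]
  exact ((contDiff_theta hm).differentiable_iteratedDeriv j (by exact_mod_cast WithTop.coe_lt_top _) ξ).hasDerivAt

/-- Implicit differentiation, five times, of sin θ = ξ sin ω / ω, followed by evaluation at 0, where
sin θ = 0 and cos θ = 1. Each derivative of the right side stays polynomial in ξ and the functions
`sincOmegaⱼ`. -/
theorem iteratedDeriv_theta_zero (hm : 0 < m) :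
    iteratedDeriv 1 (theta m) 0 = sincOmega m 0 ∧ iteratedDeriv 2 (theta m) 0 = 0 ∧
    iteratedDeriv 3 (theta m) 0 = 3 * sincOmega₁ m 0 + sincOmega m 0 ^ 3 ∧
    iteratedDeriv 4 (theta m) 0 = 0 ∧
    iteratedDeriv 5 (theta m) 0 = -15 * sincOmega₂ m 0 - sincOmega m 0 ^ 5 +
      10 * sincOmega m 0 ^ 2 * iteratedDeriv 3 (theta m) 0 := by
  obtain ⟨T, hT⟩ : ∃ T : ℕ → ℝ → ℝ, T = fun j => iteratedDeriv j (theta m) := ⟨_, rfl⟩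
  have hd : ∀ j x, HasDerivAt (T j) (T (j + 1) x) x := fun j x => by
    rw [hT]; exact hasDerivAt_iteratedDeriv_theta hm j x
  have hT0 : T 0 = theta m := by rw [hT]; exact iteratedDeriv_zero
  have hT00 : T 0 0 = 0 := by rw [hT0, theta_zero]
  simp only [show ∀ j, iteratedDeriv j (theta m) = T j from fun j => by rw [hT]]
  have hs : ∀ x, HasDerivAt (fun x => Real.sin (T 0 x)) (Real.cos (T 0 x) * T 1 x) x :=
    fun x => (hd 0 x).sin
  have hc : ∀ x, HasDerivAt (fun x => Real.cos (T 0 x)) (-Real.sin (T 0 x) * T 1 x) x :=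
    fun x => (hd 0 x).cos
  have hS := hasDerivAt_sincOmega hm
  have hV := hasDerivAt_sincOmega₁ hm
  have hY := hasDerivAt_sincOmega₂ hm
  have hZ := hasDerivAt_sincOmega₃ hm
  have step : ∀ {f g f' g' : ℝ → ℝ}, (∀ x, f x = g x) → (∀ x, HasDerivAt f (f' x) x) →
      (∀ x, HasDerivAt g (g' x) x) → ∀ x, f' x = g' x := fun {f g f' g'} h hf hg x => by
    have : f = g := funext h
    subst this
    exact (hf x).unique (hg x)
  have h0 : ∀ x, Real.sin (T 0 x) = x * sincOmega m x := fun x => by rw [hT0, sin_theta hm]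
  have h1 : ∀ x, Real.cos (T 0 x) * T 1 x = sincOmega m x + x ^ 2 * sincOmega₁ m x :=
    step h0 hs fun x => ((hasDerivAt_id x).mul (hS x)).congr_deriv (by simp only [id]; ring)
  have h2 : ∀ x, -Real.sin (T 0 x) * T 1 x ^ 2 + Real.cos (T 0 x) * T 2 x =
      3 * x * sincOmega₁ m x - x ^ 3 * sincOmega₂ m x :=
    step h1 (fun x => ((hc x).mul (hd 1 x)).congr_deriv (by ring))
      fun x => ((hS x).add ((hasDerivAt_pow 2 x).mul (hV x))).congr_deriv (by push_cast; ring)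
  have h3 : ∀ x, -Real.cos (T 0 x) * T 1 x ^ 3 - 3 * Real.sin (T 0 x) * T 1 x * T 2 x +
      Real.cos (T 0 x) * T 3 x =
      3 * sincOmega₁ m x - 6 * x ^ 2 * sincOmega₂ m x - x ^ 4 * sincOmega₃ m x :=
    step h2 (fun x => (((hs x).neg.mul ((hd 1 x).pow 2)).add ((hc x).mul (hd 2 x))).congr_deriv
        (by simp only [Pi.neg_apply, Pi.pow_apply]; push_cast; ring))
      fun x => ((((hasDerivAt_id x).const_mul 3).mul (hV x)).sub
        ((hasDerivAt_pow 3 x).mul (hY x))).congr_deriv (by simp only [id]; push_cast; ring)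
  have h4 : ∀ x, Real.sin (T 0 x) * T 1 x ^ 4 - 6 * Real.cos (T 0 x) * T 1 x ^ 2 * T 2 x -
      3 * Real.sin (T 0 x) * T 2 x ^ 2 - 4 * Real.sin (T 0 x) * T 1 x * T 3 x +
      Real.cos (T 0 x) * T 4 x =
      -15 * x * sincOmega₂ m x - 10 * x ^ 3 * sincOmega₃ m x + x ^ 5 * sincOmega₄ m x :=
    step h3 (fun x => (((((hc x).neg.mul ((hd 1 x).pow 3)).sub
        ((((hs x).const_mul 3).mul (hd 1 x)).mul (hd 2 x)))).add
        ((hc x).mul (hd 3 x))).congr_deriv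
        (by simp only [Pi.neg_apply, Pi.pow_apply, Pi.mul_apply]; push_cast; ring))
      fun x => ((((hV x).const_mul 3).sub (((hasDerivAt_pow 2 x).const_mul 6).mul (hY x))).sub
        ((hasDerivAt_pow 4 x).mul (hZ x))).congr_deriv (by push_cast; ring)
  -- Continuity of `sincOmega₄` suffices here: the factor x⁵ makes the derivative at 0 vanish.
  have hW : HasDerivAt (fun x => x ^ 5 * sincOmega₄ m x) 0 0 := by
    have h : HasDerivAt (fun x => x * (x ^ 4 * sincOmega₄ m x)) (0 ^ 4 * sincOmega₄ m 0) 0 := by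
      have hcont : Continuous fun x : ℝ => x ^ 4 * sincOmega₄ m x :=
        (continuous_pow 4).mul (continuous_sincOmega₄ hm)
      rw [hasDerivAt_iff_tendsto_slope]
      refine ((hcont.tendsto 0).mono_left nhdsWithin_le_nhds).congr' ?_
      filter_upwards [self_mem_nhdsWithin] with x hx
      have : x ≠ 0 := hx
      simp [slope_def_field, this]
    refine (h.congr_deriv (by ring)).congr_of_eventuallyEq (Filter.Eventually.of_forall fun x => ?_)
    simp only; ring
  have hL := ((((((hs 0).mul ((hd 1 0).pow 4)).sub
    ((((hc 0).const_mul 6).mul ((hd 1 0).pow 2)).mul (hd 2 0))).sub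
    (((hs 0).const_mul 3).mul ((hd 2 0).pow 2))).sub
    ((((hs 0).const_mul 4).mul (hd 1 0)).mul (hd 3 0))).add ((hc 0).mul (hd 4 0)))
  have hR := ((((hasDerivAt_id (0 : ℝ)).const_mul (-15)).mul (hY 0)).sub
    (((hasDerivAt_pow 3 (0 : ℝ)).const_mul 10).mul (hZ 0))).add hW
  have h5 := hL.unique (hR.congr_of_eventuallyEq (Filter.Eventually.of_forall h4))
  have g1 := h1 0
  have g2 := h2 0
  have g3 := h3 0
  have g4 := h4 0
  simp [hT00] at g1 g2 g3 g4 h5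
  rw [g2] at g4 h5
  simp at g4 h5
  rw [← g1]
  refine ⟨rfl, g2, by linarith, g4, by linarith⟩

/-- With S = sin m / m, the condition θ'''(0) = 0 reads 3 `sincOmega₁ m 0` = -S³. Substituting it
turns θ⁽⁵⁾(0) into -S (15 (1 - S²) / m² + S⁴), whose bracket is positive because S² ≤ 1 and S ≠ 0.
-/
theorem theta_derivatives_of_mem (hm : m ∈ exceptionalMasses) :
    iteratedDeriv 1 (theta m) 0 ≠ 0 ∧ iteratedDeriv 5 (theta m) 0 ≠ 0 := by
  obtain ⟨hm0, h3⟩ := hm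
  obtain ⟨e1, -, e3, -, e5⟩ := iteratedDeriv_theta_zero hm0
  have hom : omega m 0 = m := by simp [omega, Real.sqrt_sq hm0.le]
  rw [h3] at e3 e5
  have hV : sincOmega₁ m 0 = (Real.cos m - sincOmega m 0) / m ^ 2 := by simp [sincOmega₁, hom]
  have hY : sincOmega₂ m 0 = (sincOmega m 0 + 3 * sincOmega₁ m 0) / m ^ 2 := by simp [sincOmega₂]
  have hS : sincOmega m 0 = Real.sin m / m := by simp [sincOmega, hom]
  obtain ⟨S, hSd⟩ : ∃ S, sincOmega m 0 = S := ⟨_, rfl⟩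
  rw [hSd] at e1 e3 e5 hV hY hS
  -- If S = 0, then sin m = 0, and θ'''(0) = 0 forces cos m = 0 as well.
  have hS0 : S ≠ 0 := fun h => by
    rw [h] at e3 hV hS
    have h1 : Real.sin m = 0 := by
      rcases div_eq_zero_iff.1 hS.symm with h | h
      · exact h
      · exact absurd h hm0.ne'
    have h2 : sincOmega₁ m 0 = 0 := by linarith
    rw [h2, sub_zero] at hV
    have h4 : Real.cos m = 0 := by
      rcases div_eq_zero_iff.1 hV.symm with h | h
      · exact h
      · exact absurd h (by positivity)
    have := Real.sin_sq_add_cos_sq m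
    rw [h1, h4] at this
    norm_num at this
  have hS1 : S ^ 2 ≤ 1 := by
    rw [hS, div_pow, div_le_one (by positivity)]
    exact sq_le_sq.2 Real.abs_sin_le_abs
  refine ⟨by rwa [e1], ?_⟩
  have e6 : iteratedDeriv 5 (theta m) 0 = -(S * (15 * (1 - S ^ 2) / m ^ 2 + S ^ 4)) := by
    rw [e5, hY]
    have : 3 * sincOmega₁ m 0 = -S ^ 3 := by linarith
    rw [this]; field_simp; ring
  rw [e6, neg_ne_zero]
  refine mul_ne_zero hS0 (ne_of_gt ?_)
  have : 0 ≤ 15 * (1 - S ^ 2) / m ^ 2 := div_nonneg (by linarith) (by positivity)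
  have : 0 < S ^ 4 := by positivity
  linarith

end

/-! ### The symbol of the monodromy operator -/

section
attribute [local instance] Matrix.linftyOpNormedRing Matrix.linftyOpNormedAlgebra

/-- Since A² is the scalar w², the even and odd parts of the exponential series are the cosine and
sine series. -/
theorem exp_smul_of_sq_eq {A : Matrix (Fin 2) (Fin 2) ℂ} {w : ℝ} (hw : w ≠ 0)
    (hA : A * A = ((w : ℂ) ^ 2) • (1 : Matrix (Fin 2) (Fin 2) ℂ)) :
    NormedSpace.exp ((-Complex.I) • A) =
      (Real.cos w : ℂ) • (1 : Matrix (Fin 2) (Fin 2) ℂ) -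
        (Complex.I * (Real.sin w / w : ℝ)) • A := by
  have hwC : (w : ℂ) ≠ 0 := by exact_mod_cast hw
  set X : Matrix (Fin 2) (Fin 2) ℂ := (-Complex.I) • A with hX
  have hXX : X ^ 2 = (-((w : ℂ) ^ 2)) • (1 : Matrix (Fin 2) (Fin 2) ℂ) := by
    rw [sq, hX, smul_mul_smul_comm, hA, smul_smul]
    congr 1
    linear_combination (w : ℂ) ^ 2 * Complex.I_sq
  have heven : ∀ k : ℕ, X ^ (2 * k) = ((-1 : ℂ) ^ k * (w : ℂ) ^ (2 * k)) •
      (1 : Matrix (Fin 2) (Fin 2) ℂ) := fun k => by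
    rw [pow_mul, hXX, smul_pow, one_pow, neg_pow, pow_mul]
  have h1 : HasSum (fun k : ℕ => (((2 * k).factorial : ℂ)⁻¹) • X ^ (2 * k))
      ((Real.cos w : ℂ) • (1 : Matrix (Fin 2) (Fin 2) ℂ)) := by
    have := (Complex.hasSum_cos (w : ℂ)).smul_const (1 : Matrix (Fin 2) (Fin 2) ℂ)
    rw [← Complex.ofReal_cos] at this
    convert! this using 2 with k
    rw [heven, smul_smul]
    congr 1
    rw [div_eq_inv_mul]
  have h2 : HasSum (fun k : ℕ => (((2 * k + 1).factorial : ℂ)⁻¹) • X ^ (2 * k + 1))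
      ((Real.sin w / w : ℂ) • X) := by
    have := ((Complex.hasSum_sin (w : ℂ)).div_const (w : ℂ)).smul_const X
    rw [← Complex.ofReal_sin] at this
    convert! this using 2 with k
    rw [pow_succ, heven, smul_mul_assoc, one_mul, smul_smul]
    congr 1
    field_simp
    rw [pow_succ]
  have h3 := (NormedSpace.exp_series_hasSum_exp' (𝕂 := ℂ) X).unique (h1.even_add_odd h2)
  refine Eq.trans h3 ?_
  rw [hX, smul_smul, sub_eq_add_neg, ← neg_smul]
  congr 2
  push_cast; ring

end

theorem diracSymbol_eq (μ ξ : ℝ) : diracSymbol μ ξ = !![-(ξ : ℂ), (μ : ℂ); (μ : ℂ), (ξ : ℂ)] := by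
  ext i j; fin_cases i <;> fin_cases j <;> simp [diracSymbol, sigma1, sigma3]

theorem exp_diracSymbol {m μ : ℝ} (hm : 0 < m) (hμ : μ ^ 2 = m ^ 2) (ξ : ℝ) :
    NormedSpace.exp ((-(Complex.I * (1 : ℝ))) • diracSymbol μ ξ) =
      (Real.cos (omega m ξ) : ℂ) • (1 : Matrix (Fin 2) (Fin 2) ℂ) -
        (Complex.I * sincOmega m ξ) • diracSymbol μ ξ := by
  rw [Complex.ofReal_one, mul_one, exp_smul_of_sq_eq (omega_pos hm ξ).ne']
  · rfl
  · have h : (omega m ξ : ℂ) ^ 2 = (μ : ℂ) ^ 2 + (ξ : ℂ) ^ 2 := by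
      exact_mod_cast (omega_sq hm ξ).trans (by rw [hμ])
    rw [h, diracSymbol_eq]
    ext i j
    fin_cases i <;> fin_cases j <;> simp [Matrix.mul_apply, Fin.sum_univ_two] <;> ring

/-- The Pauli matrix `σ₂`. -/
def sigma2 : Matrix (Fin 2) (Fin 2) ℂ := !![0, -Complex.I; Complex.I, 0]

theorem norm_sigma2 (v : Spinor) : ‖Matrix.toEuclideanLin sigma2 v‖ = ‖v‖ := by
  simp [EuclideanSpace.norm_eq, Fin.sum_univ_two, sigma2, Matrix.toLpLin_apply, Matrix.vecHead,
    Matrix.vecTail]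
  rw [add_comm]

/-- The `σ₃`-component of the axis of the monodromy symbol. -/
def axisThree (m ξ : ℝ) : ℝ := Real.cos (omega m ξ) / Real.cos (theta m ξ)

/-- The `σ₂`-component of the axis of the monodromy symbol. -/
def axisTwo (m ξ : ℝ) : ℝ := sincOmega m ξ * m / Real.cos (theta m ξ)

/-- For `σ = ±1`, the spectral projection of the monodromy symbol for the
eigenvalue `e^{2iσθ}`. -/
def spectralProj (σ m ξ : ℝ) : Matrix (Fin 2) (Fin 2) ℂ :=
  (1 / 2 : ℂ) • (1 + (σ : ℂ) • ((axisThree m ξ : ℂ) • sigma3 + (axisTwo m ξ : ℂ) • sigma2))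

section
variable {m : ℝ}

theorem axis_sq (hm : 0 < m) (ξ : ℝ) : axisThree m ξ ^ 2 + axisTwo m ξ ^ 2 = 1 := by
  have h := cos_theta_pos hm ξ
  rw [axisThree, axisTwo, div_pow, div_pow, ← add_div, ← cos_theta_sq hm, div_self (by positivity)]

theorem contDiff_cos_theta (hm : 0 < m) : ContDiff ℝ ω fun ξ => Real.cos (theta m ξ) :=
  contDiff_real_cos.comp (contDiff_theta hm)

theorem contDiff_axisThree (hm : 0 < m) : ContDiff ℝ ω (axisThree m) :=
  (contDiff_real_cos.comp (contDiff_omega hm)).div (contDiff_cos_theta hm)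
    fun ξ => (cos_theta_pos hm ξ).ne'

theorem contDiff_axisTwo (hm : 0 < m) : ContDiff ℝ ω (axisTwo m) :=
  ((contDiff_sincOmega hm).mul contDiff_const).div (contDiff_cos_theta hm)
    fun ξ => (cos_theta_pos hm ξ).ne'

theorem spectralProj_eq (σ ξ : ℝ) : spectralProj σ m ξ =
    !![(1 + (σ : ℂ) * (axisThree m ξ : ℂ)) / 2, -(Complex.I * (σ * axisTwo m ξ)) / 2;
      Complex.I * (σ * axisTwo m ξ) / 2, (1 - σ * axisThree m ξ) / 2] := by
  ext i j
  fin_cases i <;> fin_cases j <;> simp [spectralProj, sigma3, sigma2] <;> ring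

theorem axis_sq_complex (hm : 0 < m) (ξ : ℝ) :
    (axisThree m ξ : ℂ) ^ 2 + (axisTwo m ξ : ℂ) ^ 2 = 1 := by
  exact_mod_cast axis_sq hm ξ

theorem spectralProj_mul_self (hm : 0 < m) {σ : ℝ} (hσ : σ ^ 2 = 1) (ξ : ℝ) :
    spectralProj σ m ξ * spectralProj σ m ξ = spectralProj σ m ξ := by
  have h := axis_sq_complex hm ξ
  have hσ' : (σ : ℂ) ^ 2 = 1 := by exact_mod_cast hσ
  have hI := Complex.I_sq
  rw [spectralProj_eq]
  ext i j
  fin_cases i <;> fin_cases j <;> simp [Matrix.mul_apply, Fin.sum_univ_two]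
  · linear_combination (1 / 4) * (σ : ℂ) ^ 2 * h + (1 / 4) * hσ' -
      (1 / 4) * ((σ : ℂ) * axisTwo m ξ) ^ 2 * hI
  · ring
  · ring
  · linear_combination (1 / 4) * (σ : ℂ) ^ 2 * h + (1 / 4) * hσ' -
      (1 / 4) * ((σ : ℂ) * axisTwo m ξ) ^ 2 * hI

theorem spectralProj_neg (σ ξ : ℝ) : spectralProj (-σ) m ξ = 1 - spectralProj σ m ξ := by
  rw [spectralProj_eq, spectralProj_eq]
  ext i j
  fin_cases i <;> fin_cases j <;> simp <;> ring

theorem spectralProj_isHermitian (σ ξ : ℝ) : (spectralProj σ m ξ).IsHermitian := by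
  rw [spectralProj_eq, Matrix.IsHermitian]
  ext i j
  fin_cases i <;> fin_cases j <;> simp

theorem rank_pos_of_trace_eq_one {A : Matrix (Fin 2) (Fin 2) ℂ} (hA : A.trace = 1) :
    0 < A.rank := by
  rw [Nat.pos_iff_ne_zero]
  intro h
  rw [Matrix.rank, Submodule.finrank_eq_zero, LinearMap.range_eq_bot] at h
  have h0 : A = 0 := by
    ext i j
    have := congrFun (LinearMap.congr_fun h (Pi.single j 1)) i
    simpa using this
  rw [h0, Matrix.trace_zero] at hA
  exact zero_ne_one hA

theorem trace_spectralProj (σ ξ : ℝ) : (spectralProj σ m ξ).trace = 1 := by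
  rw [spectralProj_eq, Matrix.trace_fin_two]
  simp; ring

/-- The two complementary projections have trace one, hence positive rank; their product is zero, so
the ranks add up to at most two. -/
theorem rank_spectralProj (hm : 0 < m) {σ : ℝ} (hσ : σ ^ 2 = 1) (ξ : ℝ) :
    (spectralProj σ m ξ).rank = 1 := by
  have h1 := rank_pos_of_trace_eq_one (trace_spectralProj (m := m) σ ξ)
  have h2 := rank_pos_of_trace_eq_one (trace_spectralProj (m := m) (-σ) ξ)
  have h3 : spectralProj σ m ξ * spectralProj (-σ) m ξ = 0 := by
    rw [spectralProj_neg, mul_sub, mul_one, spectralProj_mul_self hm hσ, sub_self]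
  have := Matrix.rank_add_rank_le_card_of_mul_eq_zero h3
  rw [Fintype.card_fin] at this
  omega

/-- With fixed matrices and real scalar coefficients, smoothness and derivatives of the projections
reduce to those of `axisThree` and `axisTwo`. -/
theorem toEuclideanLin_spectralProj (σ ξ : ℝ) (v : Spinor) :
    Matrix.toEuclideanLin (spectralProj σ m ξ) v =
      (1 / 2 : ℝ) • (v + (σ * axisThree m ξ) • Matrix.toEuclideanLin sigma3 v +
        (σ * axisTwo m ξ) • Matrix.toEuclideanLin sigma2 v) := by
  have h1 : Matrix.toEuclideanLin (1 : Matrix (Fin 2) (Fin 2) ℂ) v = v := by simp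
  rw [spectralProj, map_smul, map_add, map_smul, map_add, map_smul, map_smul,
    LinearMap.smul_apply, LinearMap.add_apply, LinearMap.smul_apply, LinearMap.add_apply,
    LinearMap.smul_apply, LinearMap.smul_apply, h1]
  simp only [← Complex.coe_smul, smul_add, smul_smul, add_assoc]
  push_cast
  rfl

/-- The symbol of the monodromy operator. -/
def monodromySymbol (m ξ : ℝ) : Matrix (Fin 2) (Fin 2) ℂ :=
  NormedSpace.exp ((-(Complex.I * (1 : ℝ))) • diracSymbol (-m) ξ) *
    NormedSpace.exp ((-(Complex.I * (1 : ℝ))) • diracSymbol m ξ)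

/-- Multiplying the two exponentials, the σ₁ terms of the masses ±m cancel, and σ₃σ₁ = iσ₂ creates a
σ₂ term. The scalar part is cos²θ - sin²θ = cos 2θ, and the rest is i sin 2θ times a unit
combination of σ₃ and σ₂. -/
theorem monodromySymbol_eq (hm : 0 < m) (ξ : ℝ) : monodromySymbol m ξ =
    phase (2 * theta m ξ) • spectralProj 1 m ξ +
      phase (-(2 * theta m ξ)) • spectralProj (-1) m ξ := by
  have hC : (Real.cos (theta m ξ) : ℂ) ≠ 0 := by exact_mod_cast (cos_theta_pos hm ξ).ne'
  have hCsq : (Real.cos (theta m ξ) : ℂ) ^ 2 =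
      (Real.cos (omega m ξ) : ℂ) ^ 2 + ((sincOmega m ξ : ℂ) * m) ^ 2 := by
    exact_mod_cast cos_theta_sq hm ξ
  have hs : (Real.sin (theta m ξ) : ℂ) = ξ * sincOmega m ξ := by exact_mod_cast sin_theta hm ξ
  have hc2 : (Real.cos (2 * theta m ξ) : ℂ) = (Real.cos (omega m ξ) : ℂ) ^ 2 +
      ((sincOmega m ξ : ℂ) * m) ^ 2 - (ξ * sincOmega m ξ) ^ 2 := by
    rw [← hCsq, ← hs, Real.cos_two_mul']; push_cast; ring
  have hs2 : (Real.sin (2 * theta m ξ) : ℂ) =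
      2 * (ξ * sincOmega m ξ) * Real.cos (theta m ξ) := by
    rw [← hs, Real.sin_two_mul]; push_cast; ring
  have ha3 : (Real.cos (theta m ξ) : ℂ) * axisThree m ξ = Real.cos (omega m ξ) := by
    rw [axisThree]; push_cast; push_cast at hC; field_simp
  have ha2 : (Real.cos (theta m ξ) : ℂ) * axisTwo m ξ = sincOmega m ξ * m := by
    rw [axisTwo]; push_cast; push_cast at hC; field_simp
  have hI := Complex.I_sq
  rw [monodromySymbol, exp_diracSymbol hm (neg_sq m), exp_diracSymbol hm rfl, diracSymbol_eq,
    diracSymbol_eq, spectralProj_eq, spectralProj_eq, phase_eq, phase_eq, Real.cos_neg,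
    Real.sin_neg, Complex.ofReal_neg (Real.sin _), hc2, hs2]
  generalize (Real.cos (omega m ξ) : ℂ) = c at *
  generalize (Real.cos (theta m ξ) : ℂ) = C at *
  generalize (sincOmega m ξ : ℂ) = S at *
  generalize (axisThree m ξ : ℂ) = a at *
  generalize (axisTwo m ξ : ℂ) = b at *
  ext i j
  fin_cases i <;> fin_cases j <;> simp [Matrix.mul_apply, Fin.sum_univ_two]
  · linear_combination (-2 * ξ * S * Complex.I) * ha3 + (S ^ 2 * ξ ^ 2 - S ^ 2 * m ^ 2) * hI
  · linear_combination (2 * ξ * S * Complex.I ^ 2) * ha2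
  · linear_combination (-2 * ξ * S * Complex.I ^ 2) * ha2
  · linear_combination (2 * ξ * S * Complex.I) * ha3 + (S ^ 2 * ξ ^ 2 - S ^ 2 * m ^ 2) * hI

theorem monodromySymbol_pow (hm : 0 < m) (ξ : ℝ) (n : ℕ) : monodromySymbol m ξ ^ n =
    phase (n * (2 * theta m ξ)) • spectralProj 1 m ξ +
      phase (n * -(2 * theta m ξ)) • spectralProj (-1) m ξ := by
  have h1 := spectralProj_mul_self hm (one_pow 2) ξ
  have h2 := spectralProj_mul_self hm (by norm_num : (-1 : ℝ) ^ 2 = 1) ξ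
  have h3 : spectralProj 1 m ξ * spectralProj (-1) m ξ = 0 := by
    rw [spectralProj_neg, mul_sub, mul_one, h1, sub_self]
  have h4 : spectralProj (-1) m ξ * spectralProj 1 m ξ = 0 := by
    rw [spectralProj_neg, sub_mul, one_mul, h1, sub_self]
  induction n with
  | zero => simp [phase_zero, spectralProj_neg]
  | succ n ih =>
    rw [pow_succ, ih, monodromySymbol_eq hm]
    simp only [add_mul, mul_add, smul_mul_smul_comm, h1, h2, h3, h4, smul_zero, add_zero,
      zero_add, ← phase_add]
    push_cast
    ring_nf

end

/-! ### Iterates of the monodromy operator -/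

theorem contDiff_toEuclideanLin_comp (A : Matrix (Fin 2) (Fin 2) ℂ) {g : ℝ → Spinor}
    {n : WithTop ℕ∞} (hg : ContDiff ℝ n g) : ContDiff ℝ n fun ξ => Matrix.toEuclideanLin A (g ξ) :=
  ((Matrix.toEuclideanLin A).toContinuousLinearMap.restrictScalars ℝ).contDiff.comp hg

theorem contDiff_fourierHat (f : 𝓢(ℝ, Spinor)) : ContDiff ℝ ∞ (fourierHat f) := by
  have : fourierHat f = fun ξ => (𝓕 f : 𝓢(ℝ, Spinor)) (ξ / (2 * Real.pi)) := by
    ext1 ξ; rw [fourierHat_eq, SchwartzMap.fourier_coe]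
  rw [this]
  exact ((𝓕 f).smooth ⊤).comp (by fun_prop)

/-- Iterating the flow composes the two transforms repeatedly. Smooth compactly supported symbols
form a class preserved by the flow on which inversion is that of Schwartz functions. -/
theorem fourierHat_fourierCheck {g : ℝ → Spinor} (hg : ContDiff ℝ ∞ g)
    (hs : HasCompactSupport g) : fourierHat (fourierCheck g) = g := by
  have h2 : (0 : ℝ) < 2 * Real.pi := by positivity
  have hg2 : ContDiff ℝ ∞ fun v : ℝ => g (v * (2 * Real.pi)) := hg.comp (by fun_prop)
  have hs2 : HasCompactSupport fun v : ℝ => g (v * (2 * Real.pi)) :=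
    hs.comp_homeomorph (Homeomorph.mulRight₀ (2 * Real.pi) h2.ne')
  set G : 𝓢(ℝ, Spinor) := hs2.toSchwartzMap hg2 with hG
  have hc : fourierCheck g = (𝓕⁻ G : 𝓢(ℝ, Spinor)) := by
    ext1 x
    rw [SchwartzMap.fourierInv_coe, Real.fourierInv_eq', fourierCheck]
    have h5 := Measure.integral_comp_mul_right
      (fun ξ : ℝ => Complex.exp (Complex.I * ξ * x) • g ξ) (2 * Real.pi)
    rw [abs_of_pos (inv_pos.2 h2)] at h5
    rw [← Complex.ofReal_inv, Complex.coe_smul, ← h5]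
    congr 1; ext1 v
    rw [hG, HasCompactSupport.toSchwartzMap_toFun]
    congr 2
    simp only [RCLike.inner_apply, conj_trivial]
    push_cast; ring
  ext1 ξ
  rw [hc, fourierHat_eq, ← SchwartzMap.fourier_coe, FourierTransform.fourier_fourierInv_eq, hG,
    HasCompactSupport.toSchwartzMap_toFun]
  rw [div_mul_cancel₀ _ h2.ne']

theorem contDiff_exp_diracSymbol_apply {m μ : ℝ} (hm : 0 < m) (hμ : μ ^ 2 = m ^ 2)
    {g : ℝ → Spinor} (hg : ContDiff ℝ ∞ g) : ContDiff ℝ ∞ fun ξ =>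
      Matrix.toEuclideanLin (NormedSpace.exp ((-(Complex.I * (1 : ℝ))) • diracSymbol μ ξ)) (g ξ) := by
  have h : (fun ξ =>
      Matrix.toEuclideanLin (NormedSpace.exp ((-(Complex.I * (1 : ℝ))) • diracSymbol μ ξ)) (g ξ)) =
      fun ξ => Real.cos (omega m ξ) • g ξ - Complex.I • (sincOmega m ξ • ((-ξ) •
        Matrix.toEuclideanLin sigma3 (g ξ) + μ • Matrix.toEuclideanLin sigma1 (g ξ))) := by
    ext1 ξ
    have h1 : Matrix.toEuclideanLin (1 : Matrix (Fin 2) (Fin 2) ℂ) (g ξ) = g ξ := by simp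
    rw [exp_diracSymbol hm hμ, map_sub, map_smul, map_smul, LinearMap.sub_apply,
      LinearMap.smul_apply, LinearMap.smul_apply, h1, diracSymbol_apply, mul_smul]
    simp only [← Complex.coe_smul, Complex.ofReal_neg]
  rw [h]
  have hc : ContDiff ℝ ∞ fun ξ => Real.cos (omega m ξ) :=
    (contDiff_real_cos.comp (contDiff_omega hm)).of_le le_top
  have hS : ContDiff ℝ ∞ (sincOmega m) := (contDiff_sincOmega hm).of_le le_top
  have h3 := contDiff_toEuclideanLin_comp sigma3 hg
  have h1 := contDiff_toEuclideanLin_comp sigma1 hg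
  fun_prop

theorem hasCompactSupport_toEuclideanLin {A : ℝ → Matrix (Fin 2) (Fin 2) ℂ} {g : ℝ → Spinor}
    (hs : HasCompactSupport g) : HasCompactSupport fun ξ => Matrix.toEuclideanLin (A ξ) (g ξ) :=
  hs.mono fun ξ h h0 => h (by simp only; rw [h0, map_zero])

theorem monodromy_fourierCheck {m : ℝ} (hm : 0 < m) {g : ℝ → Spinor} (hg : ContDiff ℝ ∞ g)
    (hs : HasCompactSupport g) : monodromy m (fourierCheck g) =
      fourierCheck fun ξ => Matrix.toEuclideanLin (monodromySymbol m ξ) (g ξ) := by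
  rw [monodromy, diracFlow, diracFlow, fourierHat_fourierCheck hg hs, fourierHat_fourierCheck
    (contDiff_exp_diracSymbol_apply hm rfl hg) (hasCompactSupport_toEuclideanLin hs)]
  congr 1; ext1 ξ
  rw [monodromySymbol, Matrix.toLpLin_mul_same, LinearMap.comp_apply]

theorem contDiff_monodromySymbol_apply {m : ℝ} (hm : 0 < m) {g : ℝ → Spinor}
    (hg : ContDiff ℝ ∞ g) :
    ContDiff ℝ ∞ fun ξ => Matrix.toEuclideanLin (monodromySymbol m ξ) (g ξ) := by
  have := contDiff_exp_diracSymbol_apply hm (neg_sq m) (contDiff_exp_diracSymbol_apply hm rfl hg)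
  simp only [monodromySymbol, Matrix.toLpLin_mul_same, LinearMap.comp_apply]
  exact this

theorem iterate_monodromy_fourierCheck {m : ℝ} (hm : 0 < m) (n : ℕ) {g : ℝ → Spinor}
    (hg : ContDiff ℝ ∞ g) (hs : HasCompactSupport g) : (monodromy m)^[n] (fourierCheck g) =
      fourierCheck fun ξ => Matrix.toEuclideanLin (monodromySymbol m ξ ^ n) (g ξ) := by
  induction n generalizing g with
  | zero => simp
  | succ n ih =>
    rw [Function.iterate_succ_apply, monodromy_fourierCheck hm hg hs,
      ih (contDiff_monodromySymbol_apply hm hg) (hasCompactSupport_toEuclideanLin hs)]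
    congr 1; ext1 ξ
    rw [pow_succ, Matrix.toLpLin_mul_same, LinearMap.comp_apply]

theorem iterate_monodromy_apply {m δ : ℝ} (hm : 0 < m) (f : 𝓢(ℝ, Spinor))
    (hf : Function.support (fourierHat f) ⊆ Ioo (-δ) δ) (n : ℕ) (x : ℝ) :
    ((monodromy m)^[n] f) x = ((2 * Real.pi : ℝ) : ℂ)⁻¹ •
      ((∫ ξ in (-δ)..δ, phase (ξ * x + n * (2 * theta m ξ)) •
        Matrix.toEuclideanLin (spectralProj 1 m ξ) (fourierHat f ξ)) +
      ∫ ξ in (-δ)..δ, phase (ξ * x + n * -(2 * theta m ξ)) •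
        Matrix.toEuclideanLin (spectralProj (-1) m ξ) (fourierHat f ξ)) := by
  have hs : HasCompactSupport (fourierHat f) :=
    HasCompactSupport.of_support_subset_isCompact isCompact_Icc (hf.trans Ioo_subset_Icc_self)
  conv_lhs => rw [← fourierCheck_fourierHat f, iterate_monodromy_fourierCheck hm n
    (contDiff_fourierHat f) hs, fourierCheck]
  congr 1
  have hth := (contDiff_theta hm).continuous
  have hpc : ∀ σ : ℝ, Continuous fun ξ =>
      Matrix.toEuclideanLin (spectralProj σ m ξ) (fourierHat f ξ) := fun σ => by
    have h3 := (contDiff_axisThree hm).continuous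
    have h2 := (contDiff_axisTwo hm).continuous
    have hf := contDiff_fourierHat f
    have hf' := hf.continuous
    have g3 := (contDiff_toEuclideanLin_comp sigma3 hf).continuous
    have g2 := (contDiff_toEuclideanLin_comp sigma2 hf).continuous
    simp only [toEuclideanLin_spectralProj]
    fun_prop
  have hpi : ∀ σ s : ℝ, IntervalIntegrable (fun ξ => phase (ξ * x + n * (s * theta m ξ)) •
      Matrix.toEuclideanLin (spectralProj σ m ξ) (fourierHat f ξ)) volume (-δ) δ := fun σ s =>
    (((by fun_prop : Continuous fun ξ => phase (ξ * x + n * (s * theta m ξ)))).smul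
      (hpc σ)).intervalIntegrable _ _
  simp only [← neg_mul]
  rw [← intervalIntegral.integral_add (hpi _ _) (hpi _ _)]
  rw [← intervalIntegral.integral_eq_integral_of_support_subset (a := -δ) (b := δ)]
  · refine intervalIntegral.integral_congr fun ξ _ => ?_
    rw [monodromySymbol_pow hm, map_add, map_smul, map_smul, LinearMap.add_apply,
      LinearMap.smul_apply, LinearMap.smul_apply, smul_add, smul_smul, smul_smul, phase_add,
      phase_add, neg_mul]
    have hx : Complex.exp (Complex.I * ξ * x) = phase (ξ * x) := by
      rw [phase]; push_cast; ring_nf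
    rw [hx]
  · intro ξ hξ
    refine Ioo_subset_Ioc_self (hf fun h0 => hξ ?_)
    simp only
    rw [h0, map_zero, smul_zero]

/-! ### A coordinate in which the phase is a fifth power -/

/-- Factor ψ = x⁵ q with q(0) ≠ 0 and take y = σ x (σq)^{1/5}, where σ is the sign of q(0). The real
power is then applied to a positive number, where it is analytic. -/
theorem exists_fifth_root {ψ : ℝ → ℝ} (hψ : AnalyticAt ℝ ψ 0)
    (h5 : analyticOrderAt ψ 0 = (5 : ℕ)) :
    ∃ (y : ℝ → ℝ) (c σ : ℝ), 0 < c ∧ (σ = 1 ∨ σ = -1) ∧ AnalyticAt ℝ y 0 ∧ y 0 = 0 ∧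
      0 < σ * deriv y 0 ∧
      ∀ᶠ x in 𝓝 0, y x ^ 5 = ψ x ∧ c * |x| ≤ |y x| ∧ 0 ≤ σ * (x * y x) := by
  obtain ⟨q, hq, hq0, hψq⟩ := hψ.analyticOrderAt_eq_natCast.1 h5
  obtain ⟨σ, hσ, hσq⟩ : ∃ σ : ℝ, (σ = 1 ∨ σ = -1) ∧ 0 < σ * q 0 := by
    rcases lt_or_gt_of_ne hq0 with h | h
    · exact ⟨-1, Or.inr rfl, by linarith⟩
    · exact ⟨1, Or.inl rfl, by linarith⟩
  have hσ2 : σ * σ = 1 := by rcases hσ with rfl | rfl <;> norm_num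
  set p : ℝ → ℝ := fun x => (σ * q x) ^ (1 / 5 : ℝ) with hp
  have hpa : AnalyticAt ℝ p 0 := by
    have h1 : ContDiffAt ℝ ω (fun x : ℝ => x ^ (1 / 5 : ℝ)) (σ * q 0) :=
      Real.contDiffAt_rpow_const_of_ne hσq.ne'
    have h2 : AnalyticAt ℝ (fun x => σ * q x) 0 := analyticAt_const.mul hq
    exact h1.analyticAt.comp_of_eq h2 rfl
  have hp0 : 0 < p 0 := Real.rpow_pos_of_pos hσq _
  have hya : AnalyticAt ℝ (fun x => x * (σ * p x)) 0 :=
    analyticAt_id.mul (analyticAt_const.mul hpa)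
  refine ⟨fun x => x * (σ * p x), p 0 / 2, σ, by positivity, hσ, hya, by simp, ?_, ?_⟩
  · have h1 := (hasDerivAt_id (0 : ℝ)).mul (hpa.differentiableAt.hasDerivAt.const_mul σ)
    have h2 : deriv (fun x => x * (σ * p x)) 0 = σ * p 0 := by
      refine Eq.trans h1.deriv ?_
      simp
    rw [h2, ← mul_assoc, hσ2, one_mul]
    exact hp0
  · have e1 : ∀ᶠ x in 𝓝 (0 : ℝ), 0 < σ * q x :=
      (continuousAt_const.mul hq.continuousAt).eventually_const_lt hσq
    have e2 : ∀ᶠ x in 𝓝 (0 : ℝ), p 0 / 2 < p x :=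
      hpa.continuousAt.eventually_const_lt (by linarith)
    filter_upwards [hψq, e1, e2] with x hx1 hx2 hx3
    have hpx : 0 < p x := by linarith
    refine ⟨?_, ?_, ?_⟩
    · have h1 : p x ^ 5 = σ * q x := by
        rw [hp]
        simp only
        rw [← Real.rpow_natCast, ← Real.rpow_mul hx2.le]
        norm_num
      rw [hx1, sub_zero, smul_eq_mul]
      calc (x * (σ * p x)) ^ 5 = x ^ 5 * (σ * σ) * (σ * σ) * σ * p x ^ 5 := by ring
        _ = x ^ 5 * (σ * σ) * (σ * σ) * (σ * σ) * q x := by rw [h1]; ring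
        _ = _ := by rw [hσ2]; ring
    · have h1 : |σ| = 1 := by rcases hσ with rfl | rfl <;> simp
      rw [abs_mul, abs_mul, h1, one_mul, abs_of_pos hpx, mul_comm]
      gcongr
    · have : σ * (x * (x * (σ * p x))) = (σ * σ) * (x * x) * p x := by ring
      rw [this, hσ2, one_mul]
      exact mul_nonneg (mul_self_nonneg x) hpx.le

/-- A neighbourhood of zero on which the phase `2 (θ(ξ) - θ'(0) ξ)` is the fifth power of an
analytic coordinate `y`, while `θ⁽⁵⁾` and `θ' + θ'(0)` do not vanish. -/
structure QuinticChart (m : ℝ) where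
  /-- The radius of the neighbourhood. -/
  δ : ℝ
  /-- The coordinate. -/
  y : ℝ → ℝ
  /-- A lower bound for the slopes of the coordinate. -/
  c : ℝ
  /-- A lower bound for the fifth derivative of the dispersion relation. -/
  κ : ℝ
  /-- The sign of the derivative of the coordinate. -/
  σ : ℝ
  δ_pos : 0 < δ
  c_pos : 0 < c
  κ_pos : 0 < κ
  σ_eq : σ = 1 ∨ σ = -1
  y_zero : y 0 = 0
  sign_deriv : 0 < σ * deriv y 0
  analyticAt_y : ∀ x ∈ Icc (-δ) δ, AnalyticAt ℝ y x
  deriv_ne_zero : ∀ x ∈ Icc (-δ) δ, deriv y x ≠ 0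
  le_abs : ∀ x ∈ Icc (-δ) δ, c * |x| ≤ |y x|
  sign : ∀ x ∈ Icc (-δ) δ, 0 ≤ σ * (x * y x)
  y_pow : ∀ x ∈ Icc (-δ) δ, y x ^ 5 = 2 * (theta m x - iteratedDeriv 1 (theta m) 0 * x)
  le_fifth : ∀ x ∈ Icc (-δ) δ, κ ≤ |iteratedDeriv 5 (theta m) x|
  first_ne_zero : ∀ x ∈ Icc (-δ) δ, iteratedDeriv 1 (theta m) x + iteratedDeriv 1 (theta m) 0 ≠ 0

theorem continuous_iteratedDeriv_theta {m : ℝ} (hm : 0 < m) (j : ℕ) :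
    Continuous (iteratedDeriv j (theta m)) :=
  continuous_iff_continuousAt.2 fun ξ => (hasDerivAt_iteratedDeriv_theta hm j ξ).continuousAt

/-- Orders 2 and 4 vanish for every mass, order 1 by the subtraction, order 3 by membership in Σ;
order 5 survives. -/
theorem analyticOrderAt_reduced_phase {m : ℝ} (hm : m ∈ exceptionalMasses) :
    analyticOrderAt (fun x => 2 * (theta m x - iteratedDeriv 1 (theta m) 0 * x)) 0 = (5 : ℕ) := by
  obtain ⟨-, e2, -, e4, -⟩ := iteratedDeriv_theta_zero hm.1
  have hd := hasDerivAt_iteratedDeriv_theta hm.1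
  set ψ : ℝ → ℝ := fun x => 2 * (theta m x - iteratedDeriv 1 (theta m) 0 * x) with hψ
  have ha : AnalyticAt ℝ ψ 0 := by
    have : AnalyticAt ℝ (theta m) 0 := (contDiff_theta hm.1).contDiffAt.analyticAt
    fun_prop
  have d1 : iteratedDeriv 1 ψ =
      fun x => 2 * (iteratedDeriv 1 (theta m) x - iteratedDeriv 1 (theta m) 0) := by
    ext x
    have h := hd 0 x
    rw [iteratedDeriv_zero] at h
    rw [iteratedDeriv_one]
    refine ((h.sub ((hasDerivAt_id x).const_mul _)).const_mul 2).deriv.trans ?_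
    simp
  have d2 : ∀ j, iteratedDeriv (j + 2) ψ = fun x => 2 * iteratedDeriv (j + 2) (theta m) x := by
    intro j
    induction j with
    | zero =>
      rw [zero_add, iteratedDeriv_succ, d1]
      ext x
      exact (((hd 1 x).sub_const _).const_mul 2).deriv
    | succ j ih =>
      rw [iteratedDeriv_succ, ih]
      ext x
      exact ((hd (j + 2) x).const_mul 2).deriv
  rw [analyticOrderAt_eq_nat_iff_iteratedDeriv_eq_zero ha]
  refine ⟨fun k hk => ?_, ?_⟩
  · interval_cases k
    · simp [hψ, theta_zero]
    · rw [d1]; simp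
    · rw [d2 0]; simp [e2]
    · rw [d2 1]; simp [hm.2]
    · rw [d2 2]; simp [e4]
  · rw [d2 3]
    simpa using (theta_derivatives_of_mem hm).2

theorem exists_quinticChart {m : ℝ} (hm : m ∈ exceptionalMasses) : Nonempty (QuinticChart m) := by
  obtain ⟨h1, h5⟩ := theta_derivatives_of_mem hm
  have hd := hasDerivAt_iteratedDeriv_theta hm.1
  have ha : AnalyticAt ℝ (fun x => 2 * (theta m x - iteratedDeriv 1 (theta m) 0 * x)) 0 := by
    have : AnalyticAt ℝ (theta m) 0 := (contDiff_theta hm.1).contDiffAt.analyticAt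
    fun_prop
  obtain ⟨y, c, σ, hc, hσ, hy, hy0, hsd, hev⟩ :=
    exists_fifth_root ha (analyticOrderAt_reduced_phase hm)
  have hdy : deriv y 0 ≠ 0 := fun h => by rw [h, mul_zero] at hsd; exact lt_irrefl _ hsd
  have hκ : 0 < |iteratedDeriv 5 (theta m) 0| := abs_pos.2 h5
  have e1 : ∀ᶠ x in 𝓝 (0 : ℝ), |iteratedDeriv 5 (theta m) 0| / 2 < |iteratedDeriv 5 (theta m) x| :=
    (continuous_iteratedDeriv_theta hm.1 5).abs.continuousAt.eventually_const_lt (by linarith)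
  have e2 : ∀ᶠ x in 𝓝 (0 : ℝ),
      iteratedDeriv 1 (theta m) x + iteratedDeriv 1 (theta m) 0 ≠ 0 :=
    ((continuous_iteratedDeriv_theta hm.1 1).add continuous_const).continuousAt.eventually_ne
      (by rw [Pi.add_apply, ← two_mul]; exact mul_ne_zero two_ne_zero h1)
  have e3 : ∀ᶠ x in 𝓝 (0 : ℝ), deriv y x ≠ 0 := hy.deriv.continuousAt.eventually_ne hdy
  obtain ⟨ε, hε, hball⟩ := Metric.eventually_nhds_iff_ball.1
    ((hev.and (hy.eventually_analyticAt.and e3)).and (e1.and e2))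
  have hsub : ∀ x ∈ Icc (-(ε / 2)) (ε / 2), x ∈ Metric.ball (0 : ℝ) ε := fun x hx => by
    rw [mem_ball_zero_iff, Real.norm_eq_abs]
    exact (abs_le.2 hx).trans_lt (by linarith)
  exact ⟨{
    δ := ε / 2
    y := y
    c := c
    κ := |iteratedDeriv 5 (theta m) 0| / 2
    σ := σ
    δ_pos := by linarith
    c_pos := hc
    κ_pos := by linarith
    σ_eq := hσ
    y_zero := hy0
    sign_deriv := hsd
    analyticAt_y := fun x hx => (hball x (hsub x hx)).1.2.1
    deriv_ne_zero := fun x hx => (hball x (hsub x hx)).1.2.2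
    le_abs := fun x hx => (hball x (hsub x hx)).1.1.2.1
    sign := fun x hx => (hball x (hsub x hx)).1.1.2.2
    y_pow := fun x hx => (hball x (hsub x hx)).1.1.1
    le_fifth := fun x hx => (hball x (hsub x hx)).2.1.le
    first_ne_zero := fun x hx => (hball x (hsub x hx)).2.2 }⟩

/-! ### Oscillatory integrals in a chart -/

/-- The amplitude is divided by χ', so that the factor e^{irχ} χ' has the primitive e^{irχ} / (ir)
of modulus 1/r. -/
theorem exists_nonstationary_bound {E : Type*} [NormedAddCommGroup E] [NormedSpace ℂ E]
    [CompleteSpace E] {χ χ' χ'' : ℝ → ℝ} {g g' : ℝ → E} {a b : ℝ} (hab : a ≤ b)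
    (hχ : ∀ x ∈ Icc a b, HasDerivAt χ (χ' x) x) (hχ' : ∀ x ∈ Icc a b, HasDerivAt χ' (χ'' x) x)
    (hχ'' : ContinuousOn χ'' (Icc a b)) (hne : ∀ x ∈ Icc a b, χ' x ≠ 0)
    (hg : ∀ x ∈ Icc a b, HasDerivAt g (g' x) x) (hg' : ContinuousOn g' (Icc a b)) :
    ∃ K : ℝ, 0 ≤ K ∧ ∀ r : ℝ, 0 < r → ‖∫ x in a..b, phase (r * χ x) • g x‖ ≤ K / r := by
  have hχc : ContinuousOn χ (Icc a b) := fun x hx => (hχ x hx).continuousAt.continuousWithinAt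
  have hχ'c : ContinuousOn χ' (Icc a b) := fun x hx => (hχ' x hx).continuousAt.continuousWithinAt
  have hgc : ContinuousOn g (Icc a b) := fun x hx => (hg x hx).continuousAt.continuousWithinAt
  have hv : ∀ x ∈ Icc a b, HasDerivAt (fun x => (χ' x)⁻¹ • g x)
      ((χ' x)⁻¹ • g' x + (-χ'' x / χ' x ^ 2) • g x) x := fun x hx =>
    ((hχ' x hx).inv (hne x hx)).smul (hg x hx)
  have hv' : ContinuousOn (fun x => (χ' x)⁻¹ • g' x + (-χ'' x / χ' x ^ 2) • g x) (Icc a b) :=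
    ((hχ'c.inv₀ hne).smul hg').add
      ((hχ''.neg.div (hχ'c.pow 2) fun x hx => pow_ne_zero _ (hne x hx)).smul hgc)
  obtain ⟨G₀, hG₀⟩ := isCompact_Icc.exists_bound_of_continuousOn
    (fun x hx => (hv x hx).continuousAt.continuousWithinAt : ContinuousOn _ (Icc a b))
  obtain ⟨G₁, hG₁⟩ := isCompact_Icc.exists_bound_of_continuousOn hv'
  have ha := left_mem_Icc.2 hab
  have h0 : 0 ≤ G₀ := (norm_nonneg _).trans (hG₀ a ha)
  have h1 : 0 ≤ G₁ := (norm_nonneg _).trans (hG₁ a ha)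
  have hba := sub_nonneg.2 hab
  refine ⟨2 * G₀ + (b - a) * G₁, by positivity, fun r hr => ?_⟩
  have hrC : (r : ℂ) ≠ 0 := by exact_mod_cast hr.ne'
  have key := norm_integral_smul_le_of_hasDerivAt (F := fun x => phase (r * χ x) / (Complex.I * r))
    (e := fun x => phase (r * χ x) * χ' x) (B := 1 / r) hab (fun x hx => by
      refine ((hasDerivAt_phase_comp ((hχ x hx).const_mul r)).div_const _).congr_deriv ?_
      have := Complex.I_ne_zero
      push_cast
      field_simp)
    ((continuous_phase.comp_continuousOn (continuousOn_const.mul hχc)).mul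
      (Complex.continuous_ofReal.comp_continuousOn hχ'c))
    (fun x _ => by rw [norm_div, norm_phase, norm_mul, Complex.norm_I, one_mul, Complex.norm_real,
      Real.norm_eq_abs, abs_of_pos hr]) hv hv' hG₀ hG₁
  have e : (∫ x in a..b, phase (r * χ x) • g x) =
      ∫ x in a..b, (phase (r * χ x) * χ' x) • ((χ' x)⁻¹ • g x) := by
    refine intervalIntegral.integral_congr fun x hx => ?_
    rw [uIcc_of_le hab] at hx
    have : (χ' x : ℂ) ≠ 0 := by exact_mod_cast hne x hx
    simp only [← Complex.coe_smul, smul_smul]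
    congr 1
    push_cast
    field_simp
  rw [e]
  refine key.trans (le_of_eq ?_)
  ring

/-! ### The uniform bound -/

section
variable {m : ℝ}

theorem abs_axis_le (hm : 0 < m) (ξ : ℝ) : |axisThree m ξ| ≤ 1 ∧ |axisTwo m ξ| ≤ 1 := by
  have h := axis_sq hm ξ
  constructor <;> rw [abs_le_one_iff_mul_self_le_one] <;>
    nlinarith [sq_nonneg (axisThree m ξ), sq_nonneg (axisTwo m ξ)]

theorem norm_half_smul_add_le {s t : ℝ} (u v w : Spinor) :
    ‖(1 / 2 : ℝ) • (u + s • Matrix.toEuclideanLin sigma3 v + t • Matrix.toEuclideanLin sigma2 w)‖ ≤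
      ‖u‖ + |s| * ‖v‖ + |t| * ‖w‖ := by
  rw [norm_smul]
  have h1 : ‖(1 / 2 : ℝ)‖ ≤ 1 := by norm_num
  refine (mul_le_of_le_one_left (norm_nonneg _) h1).trans ((norm_add₃_le).trans ?_)
  rw [norm_smul, norm_smul, norm_sigma2, norm_sigma3, Real.norm_eq_abs, Real.norm_eq_abs]

theorem norm_spectralProj_le (hm : 0 < m) {τ : ℝ} (hτ : |τ| = 1) (ξ : ℝ) (w : Spinor) :
    ‖Matrix.toEuclideanLin (spectralProj τ m ξ) w‖ ≤ 3 * ‖w‖ := by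
  rw [toEuclideanLin_spectralProj]
  refine (norm_half_smul_add_le _ _ _).trans ?_
  obtain ⟨h3, h2⟩ := abs_axis_le hm ξ
  rw [abs_mul, abs_mul, hτ, one_mul, one_mul]
  nlinarith [norm_nonneg w]

theorem contDiff_spectralProj_apply (hm : 0 < m) (τ : ℝ) {g : ℝ → Spinor} (hg : ContDiff ℝ ∞ g) :
    ContDiff ℝ ∞ fun ξ => Matrix.toEuclideanLin (spectralProj τ m ξ) (g ξ) := by
  have h3 : ContDiff ℝ ∞ (axisThree m) := (contDiff_axisThree hm).of_le le_top
  have h2 : ContDiff ℝ ∞ (axisTwo m) := (contDiff_axisTwo hm).of_le le_top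
  have g3 := contDiff_toEuclideanLin_comp sigma3 hg
  have g2 := contDiff_toEuclideanLin_comp sigma2 hg
  simp only [toEuclideanLin_spectralProj]
  fun_prop

theorem hasDerivAt_spectralProj_apply (hm : 0 < m) (τ ξ : ℝ) (w : Spinor) :
    HasDerivAt (fun ξ => Matrix.toEuclideanLin (spectralProj τ m ξ) w)
      ((1 / 2 : ℝ) • (0 + (τ * deriv (axisThree m) ξ) • Matrix.toEuclideanLin sigma3 w +
        (τ * deriv (axisTwo m) ξ) • Matrix.toEuclideanLin sigma2 w)) ξ := by
  have h3 := ((contDiff_axisThree hm).differentiable (by simp) ξ).hasDerivAt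
  have h2 := ((contDiff_axisTwo hm).differentiable (by simp) ξ).hasDerivAt
  simp only [toEuclideanLin_spectralProj]
  exact (((hasDerivAt_const ξ w).add ((h3.const_mul τ).smul_const _)).add
    ((h2.const_mul τ).smul_const _)).const_smul (1 / 2 : ℝ)

/-- The jet of the phase `ξ ↦ ξ z + a θ(ξ)`. -/
def thetaJet (m z a : ℝ) : ℕ → ℝ → ℝ
  | 0 => fun ξ => ξ * z + a * theta m ξ
  | 1 => fun ξ => z + a * iteratedDeriv 1 (theta m) ξ
  | j + 2 => fun ξ => a * iteratedDeriv (j + 2) (theta m) ξ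

theorem hasDerivAt_thetaJet (hm : 0 < m) (z a : ℝ) (j : ℕ) (ξ : ℝ) :
    HasDerivAt (thetaJet m z a j) (thetaJet m z a (j + 1) ξ) ξ := by
  have hd := hasDerivAt_iteratedDeriv_theta hm
  match j with
  | 0 =>
    have h := hd 0 ξ
    rw [iteratedDeriv_zero] at h
    exact (((hasDerivAt_id ξ).mul_const z).add (h.const_mul a)).congr_deriv (by
      rw [one_mul]; rfl)
  | 1 => exact (((hd 1 ξ).const_mul a).const_add z)
  | j + 2 => exact (hd (j + 2) ξ).const_mul a

/-- The linear term ξz disappears from the fifth derivative, so the bound is uniform in z. With w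
frozen, the amplitude and its derivative are controlled by ‖w‖ alone. -/
theorem exists_kernel_bound (hm : 0 < m) {δ κ τ : ℝ} (hδ : 0 < δ) (hκ : 0 < κ)
    (hle : ∀ x ∈ Icc (-δ) δ, κ ≤ |iteratedDeriv 5 (theta m) x|) (hτ : |τ| = 1) :
    ∃ K : ℝ, 0 ≤ K ∧ ∀ n : ℕ, 1 ≤ n → ∀ (z : ℝ) (w : Spinor),
      ‖∫ ξ in (-δ)..δ, phase (ξ * z + n * (τ * (2 * theta m ξ))) •
        Matrix.toEuclideanLin (spectralProj τ m ξ) w‖ ≤ K * (n : ℝ) ^ (-(1 / 5) : ℝ) * ‖w‖ := by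
  -- The index 3 stands for order 3 + 2 = 5.
  obtain ⟨C, hC, hvdc⟩ := exists_vanDerCorput_amplitude 3
  have hc3 : Continuous (deriv (axisThree m)) := (contDiff_axisThree hm).continuous_deriv (by simp)
  have hc2 : Continuous (deriv (axisTwo m)) := (contDiff_axisTwo hm).continuous_deriv (by simp)
  obtain ⟨A, hA⟩ := isCompact_Icc.exists_bound_of_continuousOn (hc3.continuousOn (s := Icc (-δ) δ))
  obtain ⟨B, hB⟩ := isCompact_Icc.exists_bound_of_continuousOn (hc2.continuousOn (s := Icc (-δ) δ))
  have hmem : δ ∈ Icc (-δ) δ := ⟨by linarith, le_rfl⟩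
  have hA0 := (norm_nonneg _).trans (hA δ hmem)
  have hB0 := (norm_nonneg _).trans (hB δ hmem)
  refine ⟨C * (2 * κ) ^ (-(1 / 5) : ℝ) * (2 * 3 + (δ - -δ) * (A + B)), by
    have : 0 ≤ δ - -δ := by linarith
    positivity, fun n hn z w => ?_⟩
  have hn0 : (0 : ℝ) < n := by exact_mod_cast hn
  have key := hvdc (thetaJet m z (n * (τ * 2))) (fun ξ => Matrix.toEuclideanLin (spectralProj τ m ξ) w)
    (fun ξ => (1 / 2 : ℝ) • (0 + (τ * deriv (axisThree m) ξ) • Matrix.toEuclideanLin sigma3 w +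
        (τ * deriv (axisTwo m) ξ) • Matrix.toEuclideanLin sigma2 w)) (-δ) δ (n * (2 * κ))
    (3 * ‖w‖) ((A + B) * ‖w‖) (by linarith) (hasDerivAt_thetaJet hm _ _) (by positivity)
    (fun x hx => by
      change _ ≤ |n * (τ * 2) * iteratedDeriv 5 (theta m) x|
      rw [abs_mul, abs_mul, abs_mul, hτ, one_mul, Nat.abs_cast, abs_two, mul_assoc]
      gcongr
      exact hle x hx)
    (fun x _ => hasDerivAt_spectralProj_apply hm τ x w) (by fun_prop)
    (fun x _ => norm_spectralProj_le hm hτ x w)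
    (fun x hx => by
      refine (norm_half_smul_add_le _ _ _).trans ?_
      rw [norm_zero, zero_add, abs_mul, abs_mul, hτ, one_mul, one_mul, add_mul]
      gcongr
      · exact hA x hx
      · exact hB x hx)
  have e1 : (-(1 / (((3 : ℕ) : ℝ) + 2))) = (-(1 / 5) : ℝ) := by norm_num
  rw [e1, Real.mul_rpow hn0.le (by positivity)] at key
  have e2 : (∫ ξ in (-δ)..δ, phase (ξ * z + n * (τ * (2 * theta m ξ))) •
        Matrix.toEuclideanLin (spectralProj τ m ξ) w) =
      ∫ ξ in (-δ)..δ, phase (thetaJet m z (n * (τ * 2)) 0 ξ) •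
        Matrix.toEuclideanLin (spectralProj τ m ξ) w := by
    refine intervalIntegral.integral_congr fun ξ _ => ?_
    simp only [thetaJet]
    congr 2
    ring
  rw [e2]
  refine key.trans (le_of_eq ?_)
  ring

/-- Using P f̂ as amplitude would bring in f̂', which the L¹ norm does not control. Unfolding f̂ and
exchanging the integrals turns x into x - y and the amplitude into P f(y), to which the kernel bound
applies. -/
theorem exists_branch_bound (hm : 0 < m) {δ κ τ : ℝ} (hδ : 0 < δ) (hκ : 0 < κ)
    (hle : ∀ x ∈ Icc (-δ) δ, κ ≤ |iteratedDeriv 5 (theta m) x|) (hτ : |τ| = 1) :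
    ∃ K : ℝ, 0 ≤ K ∧ ∀ (f : 𝓢(ℝ, Spinor)) (n : ℕ), 1 ≤ n → ∀ x : ℝ,
      ‖∫ ξ in (-δ)..δ, phase (ξ * x + n * (τ * (2 * theta m ξ))) •
        Matrix.toEuclideanLin (spectralProj τ m ξ) (fourierHat f ξ)‖ ≤
        K * (n : ℝ) ^ (-(1 / 5) : ℝ) * ∫ y : ℝ, ‖f y‖ := by
  obtain ⟨K, hK, h⟩ := exists_kernel_bound hm hδ hκ hle hτ
  refine ⟨K, hK, fun f n hn x => ?_⟩
  have hfi : Integrable f := f.integrable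
  have hfc : Continuous f := f.continuous
  have hth := (contDiff_theta hm).continuous
  have h3 := (contDiff_axisThree hm).continuous
  have h2 := (contDiff_axisTwo hm).continuous
  have g3 : Continuous fun w : Spinor => Matrix.toEuclideanLin sigma3 w :=
    LinearMap.continuous_of_finiteDimensional _
  have g2 : Continuous fun w : Spinor => Matrix.toEuclideanLin sigma2 w :=
    LinearMap.continuous_of_finiteDimensional _
  have hexp : ∀ ξ y : ℝ, Complex.exp (-(Complex.I * ξ * y)) = phase (-(ξ * y)) := fun ξ y => by
    rw [phase]; push_cast; ring_nf
  have e1 : ∀ ξ : ℝ, phase (ξ * x + n * (τ * (2 * theta m ξ))) •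
      Matrix.toEuclideanLin (spectralProj τ m ξ) (fourierHat f ξ) =
      ∫ y : ℝ, phase (ξ * (x - y) + n * (τ * (2 * theta m ξ))) •
        Matrix.toEuclideanLin (spectralProj τ m ξ) (f y) := fun ξ => by
    have hi : Integrable fun y : ℝ => Complex.exp (-(Complex.I * ξ * y)) • f y := by
      refine hfi.norm.mono' (by fun_prop) (Filter.Eventually.of_forall fun y => ?_)
      rw [hexp, norm_smul, norm_phase, one_mul]
    have h1 := (LinearMap.toContinuousLinearMap
      (Matrix.toEuclideanLin (spectralProj τ m ξ))).integral_comp_comm hi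
    simp only [LinearMap.coe_toContinuousLinearMap'] at h1
    rw [fourierHat, ← h1, ← integral_smul]
    congr 1; ext1 y
    rw [map_smul, smul_smul, hexp, ← phase_add]
    congr 2
    ring
  have hint : Integrable (Function.uncurry fun ξ y : ℝ =>
      phase (ξ * (x - y) + n * (τ * (2 * theta m ξ))) •
        Matrix.toEuclideanLin (spectralProj τ m ξ) (f y))
      ((volume.restrict (uIoc (-δ) δ)).prod volume) := by
    have hb : Integrable (fun p : ℝ × ℝ => (3 : ℝ) * ‖f p.2‖)
        ((volume.restrict (uIoc (-δ) δ)).prod volume) := by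
      refine Integrable.mul_prod (f := fun _ : ℝ => (3 : ℝ)) (g := fun y => ‖f y‖) ?_ hfi.norm
      have : IsFiniteMeasure (volume.restrict (uIoc (-δ) δ)) := by
        rw [uIoc_of_le (by linarith)]; infer_instance
      exact integrable_const _
    refine hb.mono' (Continuous.aestronglyMeasurable ?_) (Filter.Eventually.of_forall fun p => ?_)
    · simp only [toEuclideanLin_spectralProj, Function.uncurry_def]
      fun_prop
    · rw [Function.uncurry_def]
      simp only
      rw [norm_smul, norm_phase, one_mul]
      exact norm_spectralProj_le hm hτ _ _
  simp only [e1]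
  rw [intervalIntegral_integral_swap hint, ← integral_const_mul]
  exact norm_integral_le_of_norm_le (hfi.norm.const_mul _)
    (Filter.Eventually.of_forall fun y => h n hn (x - y) (f y))

/-! ### The expansion along the two rays -/

theorem nat_rpow_fifth {n : ℕ} (hn : 1 ≤ n) : 1 ≤ (n : ℝ) ^ (1 / 5 : ℝ) ∧
    ((n : ℝ) ^ (1 / 5 : ℝ)) ^ 5 = n ∧ ((n : ℝ) ^ (1 / 5 : ℝ))⁻¹ = (n : ℝ) ^ (-(1 / 5) : ℝ) ∧
    (((n : ℝ) ^ (1 / 5 : ℝ)) ^ 2)⁻¹ = (n : ℝ) ^ (-(2 / 5) : ℝ) := by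
  have h1 : (1 : ℝ) ≤ n := by exact_mod_cast hn
  have h0 : (0 : ℝ) ≤ n := by linarith
  refine ⟨Real.one_le_rpow h1 (by norm_num), ?_, (Real.rpow_neg h0 _).symm, ?_⟩
  · rw [← Real.rpow_natCast, ← Real.rpow_mul h0]; norm_num
  · rw [← Real.rpow_natCast, ← Real.rpow_mul h0, ← Real.rpow_neg h0]; norm_num

/-- On this ray the phase is nτy⁵ = (rτy)⁵ with r = n^{1/5}, since τ⁵ = τ. Dividing the amplitude by
(τy)' supplies the Jacobian. The coordinate τy has sign τσ, and the factor τ cancels in τσ /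
(τy'(0)), so both rays have the same constant. -/
theorem exists_stationary_branch (hm : 0 < m) (D : QuinticChart m) {C τ : ℝ} {Λ : ℂ} (hC : 0 < C)
    (hΛ : ∀ T : ℝ, 0 ≤ T → ‖quinticIntegral T - Λ‖ ≤ C / (1 + T ^ 2)) (hτ : τ = 1 ∨ τ = -1)
    (f : 𝓢(ℝ, Spinor)) :
    ∃ K : ℝ, ∀ n : ℕ, 1 ≤ n →
      ‖(∫ ξ in (-D.δ)..D.δ, phase (ξ * (n * (τ * (-2 * iteratedDeriv 1 (theta m) 0))) +
          n * (τ * (2 * theta m ξ))) •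
            Matrix.toEuclideanLin (spectralProj τ m ξ) (fourierHat f ξ)) -
        (D.σ * (2 * Λ.re) / deriv D.y 0 * (n : ℝ) ^ (-(1 / 5) : ℝ)) •
          Matrix.toEuclideanLin (spectralProj τ m 0) (∫ y : ℝ, f y)‖ ≤
        K * (n : ℝ) ^ (-(2 / 5) : ℝ) := by
  have hτ2 : τ * τ = 1 := by rcases hτ with rfl | rfl <;> norm_num
  have hτ0 : τ ≠ 0 := by rcases hτ with rfl | rfl <;> norm_num
  have hδ := D.δ_pos
  have h0 : (0 : ℝ) ∈ Icc (-D.δ) D.δ := ⟨by linarith, hδ.le⟩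
  set g : ℝ → Spinor := fun ξ => Matrix.toEuclideanLin (spectralProj τ m ξ) (fourierHat f ξ) with hg
  have hgs : ContDiff ℝ ∞ g := contDiff_spectralProj_apply hm τ (contDiff_fourierHat f)
  have hgd : ∀ x, HasDerivAt g (deriv g x) x := fun x =>
    (hgs.differentiable (by simp) x).hasDerivAt
  have hgc : Continuous (deriv g) := hgs.continuous_deriv (by simp)
  have hy1 : ∀ x ∈ Icc (-D.δ) D.δ, HasDerivAt (fun x => τ * D.y x) (τ * deriv D.y x) x :=
    fun x hx => (D.analyticAt_y x hx).differentiableAt.hasDerivAt.const_mul τ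
  have hy2 : ∀ x ∈ Icc (-D.δ) D.δ,
      HasDerivAt (fun x => τ * deriv D.y x) (τ * deriv (deriv D.y) x) x :=
    fun x hx => (D.analyticAt_y x hx).deriv.differentiableAt.hasDerivAt.const_mul τ
  have hne : ∀ x ∈ Icc (-D.δ) D.δ, τ * deriv D.y x ≠ 0 := fun x hx =>
    mul_ne_zero hτ0 (D.deriv_ne_zero x hx)
  have hyc1 : ContinuousOn (fun x => τ * deriv D.y x) (Icc (-D.δ) D.δ) := fun x hx =>
    (hy2 x hx).continuousAt.continuousWithinAt
  have hyc2 : ContinuousOn (fun x => τ * deriv (deriv D.y) x) (Icc (-D.δ) D.δ) := fun x hx =>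
    (D.analyticAt_y x hx).deriv.deriv.continuousAt.continuousWithinAt.const_mul τ
  have hv : ∀ x ∈ Icc (-D.δ) D.δ, HasDerivAt (fun x => (τ * deriv D.y x)⁻¹ • g x)
      ((τ * deriv D.y x)⁻¹ • deriv g x +
        (-(τ * deriv (deriv D.y) x) / (τ * deriv D.y x) ^ 2) • g x) x := fun x hx =>
    ((hy2 x hx).inv (hne x hx)).smul (hgd x)
  have hv' : ContinuousOn (fun x => (τ * deriv D.y x)⁻¹ • deriv g x +
      (-(τ * deriv (deriv D.y) x) / (τ * deriv D.y x) ^ 2) • g x) (Icc (-D.δ) D.δ) :=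
    ((hyc1.inv₀ hne).smul hgc.continuousOn).add
      ((hyc2.neg.div (hyc1.pow 2) fun x hx => pow_ne_zero _ (hne x hx)).smul
        hgs.continuous.continuousOn)
  obtain ⟨K, hK⟩ := exists_quintic_expansion (σ := τ * D.σ) hδ D.c_pos hC hΛ (by simp [D.y_zero])
    hy1 hyc1
    (fun x hx => by
      have : |τ| = 1 := by rcases hτ with rfl | rfl <;> simp
      rw [abs_mul, this, one_mul]; exact D.le_abs x hx)
    (by rcases hτ with rfl | rfl <;> rcases D.σ_eq with h | h <;> rw [h] <;> norm_num)
    (fun x hx => by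
      have : τ * D.σ * (x * (τ * D.y x)) = (τ * τ) * (D.σ * (x * D.y x)) := by ring
      rw [this, hτ2, one_mul]
      exact D.sign x hx) hv hv'
  refine ⟨K, fun n hn => ?_⟩
  obtain ⟨hr1, hr5, hri, hri2⟩ := nat_rpow_fifth hn
  have key := hK _ hr1
  rw [div_eq_mul_inv K, hri2] at key
  refine le_of_eq_of_le (congrArg norm ?_) key
  congr 1
  · refine intervalIntegral.integral_congr fun x hx => ?_
    rw [uIcc_of_le (by linarith)] at hx
    rw [Complex.coe_smul, smul_inv_smul₀ (hne x hx), mul_pow, hr5]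
    congr 2
    have : (τ * D.y x) ^ 5 = (τ * τ) * (τ * τ) * τ * D.y x ^ 5 := by ring
    rw [this, hτ2, D.y_pow x hx]
    ring
  · have hf0 : fourierHat f 0 = ∫ y : ℝ, f y := by simp [fourierHat]
    rw [Complex.coe_smul, smul_smul, hg, ← hri]
    simp only [hf0]
    congr 1
    have hd := D.deriv_ne_zero 0 h0
    have : (n : ℝ) ^ (1 / 5 : ℝ) ≠ 0 := by linarith
    field_simp

/-- Here the phase is -2τn(θ(ξ) + θ'(0)ξ), whose derivative does not vanish on the chart. The
resulting O(1/n) is better than required. -/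
theorem exists_nonstationary_branch (hm : 0 < m) (D : QuinticChart m) {τ : ℝ}
    (hτ : τ = 1 ∨ τ = -1) (f : 𝓢(ℝ, Spinor)) :
    ∃ K : ℝ, ∀ n : ℕ, 1 ≤ n →
      ‖∫ ξ in (-D.δ)..D.δ, phase (ξ * (n * (τ * (-2 * iteratedDeriv 1 (theta m) 0))) +
          n * (-τ * (2 * theta m ξ))) •
            Matrix.toEuclideanLin (spectralProj (-τ) m ξ) (fourierHat f ξ)‖ ≤
        K * (n : ℝ) ^ (-(2 / 5) : ℝ) := by
  have hτ0 : τ ≠ 0 := by rcases hτ with rfl | rfl <;> norm_num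
  have hδ := D.δ_pos
  have hd := hasDerivAt_iteratedDeriv_theta hm
  have hgs := contDiff_spectralProj_apply hm (-τ) (contDiff_fourierHat f)
  obtain ⟨K, hK0, hK⟩ := exists_nonstationary_bound (a := -D.δ) (b := D.δ)
    (χ := fun x => (-2 * τ) * (iteratedDeriv 0 (theta m) x + x * iteratedDeriv 1 (theta m) 0))
    (χ' := fun x => (-2 * τ) * (iteratedDeriv 1 (theta m) x + 1 * iteratedDeriv 1 (theta m) 0))
    (χ'' := fun x => (-2 * τ) * iteratedDeriv 2 (theta m) x) (by linarith)
    (fun x _ => ((hd 0 x).add ((hasDerivAt_id x).mul_const _)).const_mul _)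
    (fun x _ => ((hd 1 x).add_const _).const_mul _)
    (continuous_const.mul (continuous_iteratedDeriv_theta hm 2)).continuousOn
    (fun x hx => by
      rw [one_mul]
      exact mul_ne_zero (mul_ne_zero (by norm_num) hτ0) (D.first_ne_zero x hx))
    (fun x _ => (hgs.differentiable (by simp) x).hasDerivAt)
    (hgs.continuous_deriv (by simp)).continuousOn
  refine ⟨K, fun n hn => ?_⟩
  have hn1 : (1 : ℝ) ≤ n := by exact_mod_cast hn
  have h1 := hK n (by linarith)
  have h2 : K / n ≤ K * (n : ℝ) ^ (-(2 / 5) : ℝ) := by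
    rw [div_eq_mul_inv, ← Real.rpow_neg_one]
    gcongr
    norm_num
  refine le_trans (le_of_eq (congrArg norm ?_)) (h1.trans h2)
  refine intervalIntegral.integral_congr fun x _ => ?_
  simp only [iteratedDeriv_zero]
  congr 2
  ring

theorem exists_ray_expansion (hm : 0 < m) (D : QuinticChart m) {C τ : ℝ} {Λ : ℂ} (hC : 0 < C)
    (hΛ : ∀ T : ℝ, 0 ≤ T → ‖quinticIntegral T - Λ‖ ≤ C / (1 + T ^ 2)) (hτ : τ = 1 ∨ τ = -1)
    (f : 𝓢(ℝ, Spinor)) (hf : Function.support (fourierHat f) ⊆ Ioo (-D.δ) D.δ) :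
    ∃ K : ℝ, ∀ n : ℕ, 1 ≤ n →
      ‖((monodromy m)^[n] f) (n * (τ * (-2 * iteratedDeriv 1 (theta m) 0))) -
        ((2 * Real.pi)⁻¹ * (D.σ * (2 * Λ.re) / deriv D.y 0) * (n : ℝ) ^ (-(1 / 5) : ℝ)) •
          Matrix.toEuclideanLin (spectralProj τ m 0) (∫ y : ℝ, f y)‖ ≤
        K * (n : ℝ) ^ (-(2 / 5) : ℝ) := by
  obtain ⟨K₁, h1⟩ := exists_stationary_branch hm D hC hΛ hτ f
  obtain ⟨K₂, h2⟩ := exists_nonstationary_branch hm D hτ f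
  have hπ : (0 : ℝ) ≤ (2 * Real.pi)⁻¹ := by positivity
  refine ⟨(2 * Real.pi)⁻¹ * (K₁ + K₂), fun n hn => ?_⟩
  have h1 := h1 n hn
  have h2 := h2 n hn
  have e : ((monodromy m)^[n] f) (n * (τ * (-2 * iteratedDeriv 1 (theta m) 0))) =
      (2 * Real.pi)⁻¹ • ((∫ ξ in (-D.δ)..D.δ,
          phase (ξ * (n * (τ * (-2 * iteratedDeriv 1 (theta m) 0))) +
            n * (τ * (2 * theta m ξ))) •
            Matrix.toEuclideanLin (spectralProj τ m ξ) (fourierHat f ξ)) +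
        ∫ ξ in (-D.δ)..D.δ,
          phase (ξ * (n * (τ * (-2 * iteratedDeriv 1 (theta m) 0))) +
            n * (-τ * (2 * theta m ξ))) •
            Matrix.toEuclideanLin (spectralProj (-τ) m ξ) (fourierHat f ξ)) := by
    rw [iterate_monodromy_apply hm f hf, ← Complex.ofReal_inv, Complex.coe_smul]
    rcases hτ with rfl | rfl
    · simp only [one_mul, neg_mul]
    · simp only [one_mul, neg_mul, neg_neg]
      rw [add_comm]
  rw [e, mul_assoc, mul_smul, ← smul_sub, norm_smul, Real.norm_eq_abs, abs_of_nonneg hπ, mul_assoc,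
    add_mul, add_sub_right_comm]
  gcongr
  exact (norm_add_le _ _).trans (add_le_add h1 h2)

end

end
end MassSwitching

open MassSwitching in
theorem theorem2 (m : ℝ) (hm : m ∈ exceptionalMasses) :
    iteratedDeriv 5 (theta m) 0 ≠ 0 ∧
    ∃ δ : ℝ, 0 < δ ∧
      -- the upper bound, with a constant that depends on `m` only
      (∃ K : ℝ, ∀ f : 𝓢(ℝ, Spinor), Function.support (fourierHat f) ⊆ Set.Ioo (-δ) δ →
        ∀ n : ℕ, 1 ≤ n → ∀ x : ℝ,
          ‖((monodromy m)^[n] f) x‖ ≤ K * (n : ℝ) ^ (-(1 / 5) : ℝ) * ∫ y : ℝ, ‖f y‖) ∧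
      -- the expansion, with `C`, `s₁`, `Q` that depend on `m` only
      (∃ s₁ : ℝ, s₁ ≠ 0 ∧ ∃ C : ℝ, 0 < C ∧ ∃ Q : Matrix (Fin 2) (Fin 2) ℂ,
        Q.IsHermitian ∧ Q * Q = Q ∧ Q.rank = 1 ∧
        ∀ f : 𝓢(ℝ, Spinor), Function.support (fourierHat f) ⊆ Set.Ioo (-δ) δ →
          (∃ K : ℝ, ∀ n : ℕ, 1 ≤ n →
            ‖((monodromy m)^[n] f) (n * s₁) -
                (C * (n : ℝ) ^ (-(1 / 5) : ℝ)) • Matrix.toEuclideanLin Q (∫ y : ℝ, f y)‖ ≤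
              K * (n : ℝ) ^ (-(2 / 5) : ℝ)) ∧
          (∃ K : ℝ, ∀ n : ℕ, 1 ≤ n →
            ‖((monodromy m)^[n] f) (n * (-s₁)) -
                (C * (n : ℝ) ^ (-(1 / 5) : ℝ)) •
                  Matrix.toEuclideanLin (1 - Q) (∫ y : ℝ, f y)‖ ≤
              K * (n : ℝ) ^ (-(2 / 5) : ℝ))) ∧
      -- the expansion of the modulus, for each datum
      (∀ f : 𝓢(ℝ, Spinor), Function.support (fourierHat f) ⊆ Set.Ioo (-δ) δ →
        ∃ s₁ : ℝ, s₁ ≠ 0 ∧ ∃ C : ℝ, 0 < C ∧ ∃ K : ℝ, ∀ n : ℕ, 1 ≤ n →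
          |‖((monodromy m)^[n] f) (n * s₁)‖ -
              C * ‖∫ y : ℝ, f y‖ * (n : ℝ) ^ (-(1 / 5) : ℝ)| ≤
            K * (n : ℝ) ^ (-(2 / 5) : ℝ)) := by
  have hm0 := hm.1
  obtain ⟨hT1, hT5⟩ := theta_derivatives_of_mem hm
  obtain ⟨D⟩ := exists_quinticChart hm
  obtain ⟨Λ, hΛ0, C, hC, hΛ⟩ := exists_quinticIntegral_limit
  have hray := fun (τ : ℝ) (hτ : τ = 1 ∨ τ = -1) => exists_ray_expansion hm0 D hC hΛ hτ
  -- The coefficient is positive because Re Λ > 0 and σ is the sign of y'(0).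
  have hA : 0 < (2 * Real.pi)⁻¹ * (D.σ * (2 * Λ.re) / deriv D.y 0) := by
    have h1 := D.sign_deriv
    have h2 : D.σ * (2 * Λ.re) / deriv D.y 0 =
        2 * Λ.re * (D.σ * deriv D.y 0) / (deriv D.y 0) ^ 2 := by
      have : deriv D.y 0 ≠ 0 := fun h => by rw [h, mul_zero] at h1; exact lt_irrefl _ h1
      field_simp
    have h3 : 0 < (deriv D.y 0) ^ 2 := by
      have : deriv D.y 0 ≠ 0 := fun h => by rw [h, mul_zero] at h1; exact lt_irrefl _ h1
      positivity
    rw [h2]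
    positivity
  generalize (2 * Real.pi)⁻¹ * (D.σ * (2 * Λ.re) / deriv D.y 0) = A at hray hA
  have hs : -2 * iteratedDeriv 1 (theta m) 0 ≠ 0 := mul_ne_zero (by norm_num) hT1
  generalize -2 * iteratedDeriv 1 (theta m) 0 = s at hray hs
  refine ⟨hT5, D.δ, D.δ_pos, ?_, ⟨s, hs, A, hA, spectralProj 1 m 0,
    spectralProj_isHermitian 1 0, spectralProj_mul_self hm0 (one_pow 2) 0,
    rank_spectralProj hm0 (one_pow 2) 0, fun f hf => ⟨?_, ?_⟩⟩, fun f hf => ?_⟩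
  · obtain ⟨K₁, hK₁, h1⟩ := exists_branch_bound hm0 D.δ_pos D.κ_pos D.le_fifth
      (abs_one : |(1 : ℝ)| = 1)
    obtain ⟨K₂, hK₂, h2⟩ := exists_branch_bound hm0 D.δ_pos D.κ_pos D.le_fifth
      (by simp : |(-1 : ℝ)| = 1)
    refine ⟨(2 * Real.pi)⁻¹ * (K₁ + K₂), fun f hf n hn x => ?_⟩
    have hπ : (0 : ℝ) ≤ (2 * Real.pi)⁻¹ := by positivity
    have h1 := h1 f n hn x
    have h2 := h2 f n hn x
    simp only [one_mul, neg_mul] at h1 h2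
    rw [iterate_monodromy_apply hm0 f hf, ← Complex.ofReal_inv, Complex.coe_smul, norm_smul,
      Real.norm_eq_abs, abs_of_nonneg hπ, mul_assoc, mul_assoc, add_mul, ← mul_assoc K₁,
      ← mul_assoc K₂]
    gcongr
    exact (norm_add_le _ _).trans (add_le_add h1 h2)
  · simpa only [one_mul] using hray 1 (Or.inl rfl) f hf
  · simpa only [neg_mul, one_mul, spectralProj_neg] using hray (-1) (Or.inr rfl) f hf
  -- If the mean vanishes, so does the leading term, and any positive constant will do.
  · by_cases hV : ∫ y : ℝ, f y = 0
    · obtain ⟨K, hK⟩ := hray 1 (Or.inl rfl) f hf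
      refine ⟨s, hs, 1, one_pos, K, fun n hn => ?_⟩
      have := hK n hn
      rw [hV] at this ⊢
      simpa using this
    -- The projections add up to the identity, so at least one keeps a nonzero part of the mean. The
    -- ray is chosen accordingly, and the ratio of the two norms enters the constant.
    · obtain ⟨τ, hτ, hP⟩ : ∃ τ : ℝ, (τ = 1 ∨ τ = -1) ∧
          Matrix.toEuclideanLin (spectralProj τ m 0) (∫ y : ℝ, f y) ≠ 0 := by
        by_contra! hcon
        have h1 := hcon 1 (Or.inl rfl)
        have h2 := hcon (-1) (Or.inr rfl)
        rw [spectralProj_neg, map_sub, LinearMap.sub_apply, h1, sub_zero] at h2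
        exact hV (by simpa using h2)
      obtain ⟨K, hK⟩ := hray τ hτ f hf
      have hV' := norm_pos_iff.2 hV
      have hP' := norm_pos_iff.2 hP
      refine ⟨τ * s, mul_ne_zero (by rcases hτ with rfl | rfl <;> norm_num) hs,
        A * ‖Matrix.toEuclideanLin (spectralProj τ m 0) (∫ y : ℝ, f y)‖ / ‖∫ y : ℝ, f y‖,
        by positivity, K, fun n hn => ?_⟩
      refine le_trans (le_of_eq_of_le ?_ (abs_norm_sub_norm_le _ _)) (hK n hn)
      have hn0 : 0 ≤ (n : ℝ) ^ (-(1 / 5) : ℝ) := Real.rpow_nonneg (Nat.cast_nonneg n) _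
      rw [norm_smul, Real.norm_eq_abs, abs_of_nonneg (mul_nonneg hA.le hn0),
        div_mul_cancel₀ _ hV'.ne']
      ring_nf
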